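/- Let $\Gamma$ be a metric graph, i.e. a compact connected metric space, endowed with its path metric, in which every point has a neighborhood isometric to a star-shaped set of some finite valency $n$ (that is, $n$ segments $[0,r)$ glued at $0$). Let $g=\dim_{\mathbb R} H^1(\Gamma;\mathbb R)$ be its genus. A divisor is an element $D=\sum_p D(p)\,(p)$ of the free abelian group on the points of $\Gamma$; it is effective if all $D(p)\ge 0$, its degree is $\sum_p D(p)$, and $E\le D$ means that $D-E$ is effective. Let $R(\Gamma)$ be the set of continuous functions $\phi:\Gamma\to\mathbb R$ that are piecewise affine with integer slopes along every isometric map $[0,\epsilon]\to\Gamma$, and let $\operatorname{div}(\phi)=\sum_p\sigma_p(\phi)\,(p)$, where $\sigma_p(\phi)$ is the sum of the incoming slopes of $\phi$ at $p$. Two divisors are linearly equivalent if their difference is $\operatorname{div}(\phi)$ for some $\phi\in R(\Gamma)$, and $|D|$ is the set of effective divisors linearly equivalent to $D$. An open edge of $\Gamma$ is a connected component of the complement of the set of points of valency different from $2$, and an open edge segment is a nonempty open connected subset of an open edge. A break divisor is a divisor $(p_1)+\dots+(p_g)$ for which there are pairwise disjoint open edge segments $e_1,\dots,e_g$ with $p_i\in\overline{e_i}$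 such that $\Gamma\setminus\bigcup_{i=1}^g e_i$ is contractible. A semibreak divisor is an effective divisor $E$ such that $E\le B$ for some break divisor $B$. **Theorem.** Let $\Gamma$ be a metric graph of genus $g$, let $0\le d\le g$, and let $D$ be a divisor of degree $d$ on $\Gamma$ with $|D|\ne\emptyset$. Then $|D|$ contains a semibreak divisor. -/

import Mathlib

open Set Topology

namespace TropicalGraph

noncomputable section

/-! ### Metric graphs -/

/-- `leg` is an isometric parametrization of a neighborhood of `p` by the star-shaped set of valency
`n` and radius `r`, with its path metric: the star consists of `n` half-open segments `[0, r)` glued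
at their common endpoint `0`; the point at distance `t` from the centre on the `i`-th segment is sent
to `leg i t`, and the centre is sent to `p`. (The values of `leg i` outside `[0, r)` are
irrelevant; for `n = 0` the star is a single point.) -/
structure IsStarAt {Γ : Type*} [MetricSpace Γ] (p : Γ) (n : ℕ) (r : ℝ) (leg : Fin n → ℝ → Γ) :
    Prop where
  pos : 0 < r
  center : ∀ i, leg i 0 = p
  dist_same : ∀ i, ∀ s ∈ Ico 0 r, ∀ t ∈ Ico 0 r, dist (leg i s) (leg i t) = |s - t|
  dist_ne : ∀ i j, i ≠ j → ∀ s ∈ Ico 0 r, ∀ t ∈ Ico 0 r, dist (leg i s) (leg j t) = s + t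
  mem_nhds : ({p} ∪ ⋃ i, leg i '' Ico 0 r) ∈ 𝓝 p

/-- The point `p` has valency `n`: a neighborhood of `p` is isometric to a star-shaped set of
valency `n` centred at `p`. -/
def HasValency {Γ : Type*} [MetricSpace Γ] (p : Γ) (n : ℕ) : Prop :=
  ∃ (r : ℝ) (leg : Fin n → ℝ → Γ), IsStarAt p n r leg

/-- A metric graph: a compact connected metric space in which every point has a neighborhood isometric
to a star-shaped set, and whose metric is the path metric (the distance of two points is the
infimum of the lengths of the paths that join them). -/
structure IsMetricGraph (Γ : Type*) [MetricSpace Γ] : Prop where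
  compact : CompactSpace Γ
  connected : ConnectedSpace Γ
  star : ∀ p : Γ, ∃ n, HasValency p n
  inner : ∀ x y : Γ, edist x y = ⨅ γ : Path x y, eVariationOn γ univ

/-- The branch points: the points of valency different from `2`. -/
def branchPoints (Γ : Type*) [MetricSpace Γ] : Set Γ :=
  {p | ∃ n, n ≠ 2 ∧ HasValency p n}

/-- The open edges: the connected components of the complement of the set of branch points. -/
def IsOpenEdge {Γ : Type*} [MetricSpace Γ] (e : Set Γ) : Prop :=
  ∃ x ∈ (branchPoints Γ)ᶜ, e = connectedComponentIn (branchPoints Γ)ᶜ x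

/-- An open edge segment: a (nonempty) open connected subset of an open edge. -/
def IsOpenEdgeSegment {Γ : Type*} [MetricSpace Γ] (s : Set Γ) : Prop :=
  IsOpen s ∧ IsConnected s ∧ ∃ e, IsOpenEdge e ∧ s ⊆ e

/-! ### The genus, through singular cohomology with real coefficients -/

/-- Singular `n`-simplices. -/
abbrev SingularSimplex (X : Type*) [TopologicalSpace X] (n : ℕ) : Type _ :=
  C(stdSimplex ℝ (Fin (n + 1)), X)

/-- The `i`-th face of a singular simplex. -/
def SingularSimplex.face {X : Type*} [TopologicalSpace X] {n : ℕ} (σ : SingularSimplex X (n + 1))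
    (i : Fin (n + 2)) : SingularSimplex X n :=
  σ.comp ⟨stdSimplex.map i.succAbove, stdSimplex.continuous_map _⟩

/-- The coboundary operator on real singular cochains. -/
def coboundary (X : Type*) [TopologicalSpace X] (n : ℕ) :
    (SingularSimplex X n → ℝ) →ₗ[ℝ] (SingularSimplex X (n + 1) → ℝ) where
  toFun c σ := ∑ i : Fin (n + 2), (-1 : ℝ) ^ (i : ℕ) * c (σ.face i)
  map_add' c c' := by
    funext σ
    simp [mul_add, Finset.sum_add_distrib]
  map_smul' a c := by
    funext σ
    simp [Finset.mul_sum, mul_left_comm]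

/-- The first singular cohomology group `H¹(X; ℝ)`: cocycles modulo coboundaries. -/
abbrev H1 (X : Type*) [TopologicalSpace X] : Type _ :=
  ↥(LinearMap.ker (coboundary X 1)) ⧸
    (LinearMap.range (coboundary X 0)).comap (LinearMap.ker (coboundary X 1)).subtype

/-- The genus of a metric graph, the dimension of `H¹(Γ; ℝ)`. -/
def genus (Γ : Type*) [TopologicalSpace Γ] : ℕ :=
  Module.finrank ℝ (H1 Γ)

/-! ### Divisors

Divisors are elements of the free abelian group `Γ →₀ ℤ`, with the coefficientwise order; a divisor
`D` is effective when `0 ≤ D`, and `Finsupp.degree D` is the sum of its coefficients. -/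

/-- `f` is piecewise affine with integer slopes on `[0, ε]`: there are finitely many break points such
that `f` is affine with an integer slope on every subinterval without a break point in its
interior. -/
def IsIntegralPiecewiseAffineOn (f : ℝ → ℝ) (ε : ℝ) : Prop :=
  ∃ s : Finset ℝ, ∀ x y, 0 ≤ x → x ≤ y → y ≤ ε → Disjoint (Ioo x y) (s : Set ℝ) →
    ∃ m : ℤ, ∀ t ∈ Icc x y, f t = f x + m * (t - x)

/-- Membership in `R(Γ)`: continuous functions whose pullback along every isometric map
`[0, ε] → Γ` is piecewise affine with integer slopes. -/
structure IsRational {Γ : Type*} [MetricSpace Γ] (φ : Γ → ℝ) : Prop where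
  continuous : Continuous φ
  piecewise : ∀ ε : ℝ, 0 < ε → ∀ γ : ℝ → Γ,
    (∀ s ∈ Icc 0 ε, ∀ t ∈ Icc 0 ε, dist (γ s) (γ t) = |s - t|) →
    IsIntegralPiecewiseAffineOn (fun t => φ (γ t)) ε

/-- The sum of the incoming slopes of `φ` at `p` is `k`. The slope of `φ` along a leg of a star at
`p`, in the direction away from `p`, is the outgoing slope; the incoming slope is its negative. -/
def IncomingSlopeSum {Γ : Type*} [MetricSpace Γ] (φ : Γ → ℝ) (p : Γ) (k : ℤ) : Prop :=
  ∃ (n : ℕ) (r : ℝ) (leg : Fin n → ℝ → Γ), IsStarAt p n r leg ∧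
    ∃ m : Fin n → ℤ,
      (∀ i, HasDerivWithinAt (fun t => φ (leg i t)) (m i : ℝ) (Ici 0) 0) ∧ k = ∑ i, -m i

/-- `D` is the divisor of `φ`. -/
def IsDivisorOf {Γ : Type*} [MetricSpace Γ] (φ : Γ → ℝ) (D : Γ →₀ ℤ) : Prop :=
  ∀ p, IncomingSlopeSum φ p (D p)

/-- Linear equivalence of divisors. -/
def LinearlyEquivalent {Γ : Type*} [MetricSpace Γ] (D₁ D₂ : Γ →₀ ℤ) : Prop :=
  ∃ φ : Γ → ℝ, IsRational φ ∧ IsDivisorOf φ (D₁ - D₂)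

/-- The complete linear system `|D|`: the effective divisors linearly equivalent to `D`. -/
def linearSystem {Γ : Type*} [MetricSpace Γ] (D : Γ →₀ ℤ) : Set (Γ →₀ ℤ) :=
  {E | 0 ≤ E ∧ LinearlyEquivalent E D}

/-! ### Break and semibreak divisors -/

/-- Break divisors: `D = (p₁) + ⋯ + (p_g)` with `pᵢ` in the closure of `eᵢ`, for disjoint open edge
segments `e₁, …, e_g` whose removal leaves a contractible space. -/
def IsBreakDivisor {Γ : Type*} [MetricSpace Γ] (D : Γ →₀ ℤ) : Prop :=
  ∃ (e : Fin (genus Γ) → Set Γ) (p : Fin (genus Γ) → Γ),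
    (∀ i, IsOpenEdgeSegment (e i)) ∧
    (∀ i j, i ≠ j → Disjoint (e i) (e j)) ∧
    (∀ i, p i ∈ closure (e i)) ∧
    D = ∑ i, Finsupp.single (p i) 1 ∧
    ContractibleSpace ↥((⋃ i, e i)ᶜ : Set Γ)

/-- Semibreak divisors: effective divisors dominated by a break divisor. -/
def IsSemibreakDivisor {Γ : Type*} [MetricSpace Γ] (E : Γ →₀ ℤ) : Prop :=
  0 ≤ E ∧ ∃ D, IsBreakDivisor D ∧ E ≤ D

end

end TropicalGraph

/-!
The proof presents `Γ` as a finite graph, an `EdgeModel`: finitely many isometrically parametrized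
edges with ends in a finite vertex set, which can be made to contain any given finite set of points
(`exists_edgeModel`). It has three ingredients.

* *The genus.* The genus is the number of edges outside a spanning tree (`genus_add_card`). A cocycle
  is determined up to coboundaries by its values on the edges, because a cocycle that vanishes on the
  edges vanishes on all paths: small stars contract to their centres (`along_eq_zero`). All values
  occur, by winding numbers of maps to the circle (`exists_winding`).
* *Break divisors.* The complement of the open edges outside a spanning tree is a tree, hence
  contractible (`contractibleSpace_compl`). So a divisor with at most one chip on each closed edge
  outside a spanning tree, and no other chips, is a semibreak divisor (`isSemibreakDivisor_chips`).
* *Chip firing.* If `W` is a set of vertices, and every edge that leaves `W` carries a chip, then all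
  these chips can be moved by the same distance away from `W`, up to linear equivalence
  (`exists_isPrincipal_fire`).

Start with an effective divisor in the linear system, and a model whose vertices contain its support;
its degree is `d`, since principal divisors have degree zero (`degree_eq_zero`). Its chips are put
one at a time on edges, in such a way that every chip placed so far *owns* a closed edge that contains
it, that distinct chips own distinct edges, and that the owned edges avoid a spanning tree `T`
(`exists_add_chip`). As long as fewer than `g` chips are placed, some edge `b` outside `T` is unowned.
Let `q` be an end of `b`. A new chip, at a vertex `p`, takes `b` if `p = q`. Otherwise it takes the
first edge `t` of the path in `T` from `p` to `q`, and the tree has to be repaired. To this end let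
`W` be the set of vertices that `p` separates from `q` in `T`, together with `p`, so that `t` is the
only tree edge that leaves `W`. If some edge that leaves `W` is unowned, it replaces `t` in `T`, which
finishes the repair. If all of them are owned, fire `W` until the chip on one of them, say `e`, reaches
a vertex `w` outside `W`. Then `e` replaces `t` in `T`, and its chip gives up `e` and continues from
`w` towards `q` in the same manner, with a larger set `W`. This ends at the latest when the chip arrives
at `q` and takes `b` (`exists_disjoint_tree`).
-/

open Set Topology

namespace TropicalGraph

noncomputable section

/-! ### Local structure: stars and germs of geodesics -/

/-- A property of subintervals that is additive and holds locally holds for the whole interval. -/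
theorem interval_induction {a b : ℝ} (hab : a ≤ b) (P : ℝ → ℝ → Prop)
    (hadd : ∀ x y z, a ≤ x → x ≤ y → y ≤ z → z ≤ b → P x y → P y z → P x z)
    (hloc : ∀ t ∈ Icc a b, ∃ δ > 0, ∀ x y, a ≤ x → y ≤ b → t - δ < x → x ≤ y → y < t + δ → P x y) :
    P a b := by
  choose! δ hδ hP using hloc
  obtain ⟨t, ht0, htm, ⟨m, hm⟩, ht⟩ := exists_monotone_Icc_subset_open_cover_Icc hab
    (c := fun i : Icc a b => {x : Icc a b | (i : ℝ) - δ i < x ∧ (x : ℝ) < i + δ i})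
    (fun i => by
      apply IsOpen.inter
      · exact isOpen_lt continuous_const continuous_subtype_val
      · exact isOpen_lt continuous_subtype_val continuous_const)
    (fun x _ => mem_iUnion.2 ⟨x, by
      have := hδ x x.2
      constructor <;> linarith⟩)
  have key : ∀ n, P a (t n) := by
    intro n
    induction n with
    | zero =>
      rw [ht0]
      have := hδ a ⟨le_rfl, hab⟩
      exact hP a ⟨le_rfl, hab⟩ a a le_rfl hab (by linarith) le_rfl (by linarith)
    | succ n ih =>
      obtain ⟨i, hi⟩ := ht n
      have hle : t n ≤ t (n + 1) := htm n.le_succ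
      have h1 := hi ⟨le_rfl, hle⟩
      have h2 := hi ⟨hle, le_rfl⟩
      exact hadd _ _ _ le_rfl (t n).2.1 hle (t (n + 1)).2.2 ih
        (hP i i.2 _ _ (t n).2.1 (t (n + 1)).2.2 h1.1 hle h2.2)
  simpa [hm m le_rfl] using key m

section Star

variable {Γ : Type*} [MetricSpace Γ]

theorem IsStarAt.dist_center {p : Γ} {n : ℕ} {r : ℝ} {leg : Fin n → ℝ → Γ}
    (h : IsStarAt p n r leg) (i : Fin n) {t : ℝ} (ht : t ∈ Ico 0 r) : dist (leg i t) p = t := by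
  rw [← h.center i, h.dist_same i t ht 0 ⟨le_rfl, h.pos⟩, sub_zero, abs_of_nonneg ht.1]

/-- Every point of a small ball around the centre of a star lies on a leg, at its distance from the
centre. -/
theorem IsStarAt.exists_ball {p : Γ} {n : ℕ} {r : ℝ} {leg : Fin n → ℝ → Γ}
    (h : IsStarAt p n r leg) :
    ∃ ρ, 0 < ρ ∧ ρ < r ∧ ∀ x, dist x p < ρ → x ≠ p → ∃ i, x = leg i (dist x p) := by
  obtain ⟨ρ, hρ, hb⟩ := Metric.mem_nhds_iff.1 h.mem_nhds
  have hr := h.pos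
  refine ⟨min ρ (r / 2), lt_min hρ (by linarith), (min_le_right _ _).trans_lt (by linarith), ?_⟩
  intro x hx hxp
  rcases hb (Metric.mem_ball.2 (hx.trans_le (min_le_left _ _))) with h1 | h1
  · exact absurd h1 hxp
  · obtain ⟨i, s, hs, rfl⟩ := mem_iUnion.1 h1
    exact ⟨i, by rw [h.dist_center i hs]⟩

/-- `c` is an isometric path on `[0, δ)` that starts at `p`. -/
structure IsGerm (c : ℝ → Γ) (p : Γ) (δ : ℝ) : Prop where
  pos : 0 < δ
  zero : c 0 = p
  dist_eq : ∀ s ∈ Ico 0 δ, ∀ t ∈ Ico 0 δ, dist (c s) (c t) = |s - t|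

/-- The germ of a geodesic at `p` agrees with a leg of any given star at `p`: two points of the
geodesic at distances `s`, `t` from `p` are at distance `|s - t| < s + t`. -/
theorem IsGerm.eq_leg {c : ℝ → Γ} {p : Γ} {δ : ℝ} (hc : IsGerm c p δ) {n : ℕ} {r : ℝ}
    {leg : Fin n → ℝ → Γ} (h : IsStarAt p n r leg) :
    ∃ i, ∃ δ' > 0, ∀ s ∈ Ico 0 δ', c s = leg i s := by
  obtain ⟨ρ, hρ, hρr, hb⟩ := h.exists_ball
  have hδ := hc.pos
  have hdc : ∀ s ∈ Ico 0 δ, dist (c s) p = s := fun s hs => by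
    rw [← hc.zero, hc.dist_eq s hs 0 ⟨le_rfl, hδ⟩, sub_zero, abs_of_nonneg hs.1]
  have hon : ∀ s, 0 < s → s < min δ ρ → ∃ i, c s = leg i s := by
    intro s hs hs'
    have hd := hdc s ⟨hs.le, hs'.trans_le (min_le_left _ _)⟩
    obtain ⟨i, hi⟩ := hb (c s) (by rw [hd]; exact hs'.trans_le (min_le_right _ _))
      (fun he => by rw [he, dist_self] at hd; linarith)
    exact ⟨i, by rw [hd] at hi; exact hi⟩
  have hmin : 0 < min δ ρ := lt_min hδ hρ
  set u := min δ ρ / 2 with hu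
  obtain ⟨i, hi⟩ := hon u (by linarith) (by linarith)
  refine ⟨i, u, by linarith, fun s hs => ?_⟩
  rcases hs.1.eq_or_lt with rfl | hs0
  · rw [hc.zero, h.center]
  · have hsu : s < min δ ρ := by linarith [hs.2]
    obtain ⟨j, hj⟩ := hon s hs0 hsu
    by_cases hij : j = i
    · rw [hj, hij]
    · exfalso
      have h1 := min_le_left δ ρ
      have h2 := min_le_right δ ρ
      have e1 := h.dist_ne j i hij s ⟨hs0.le, by linarith⟩ u ⟨by linarith, by linarith⟩
      rw [← hj, ← hi, hc.dist_eq s ⟨hs0.le, by linarith⟩ u ⟨by linarith, by linarith⟩,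
        abs_of_neg (by linarith [hs.2])] at e1
      linarith

end Star

/-! ### Finite edge models of a metric graph -/

/-- A presentation of `Γ` as a finite graph: a finite vertex set `V`, and finitely many edges, the
`e`-th one parametrized isometrically by `γ e` on `[0, len e]`, with ends in `V` and with open,
pairwise disjoint interiors that cover the complement of `V`. There are no loops, since `γ e` is
injective; parallel edges are allowed. The values of `γ e` outside `[0, len e]` are irrelevant. -/
structure EdgeModel (Γ : Type*) [MetricSpace Γ] where
  V : Finset Γ
  n : ℕ
  len : Fin n → ℝ
  γ : Fin n → ℝ → Γ
  len_pos : ∀ e, 0 < len e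
  dist_eq : ∀ e, ∀ s ∈ Icc 0 (len e), ∀ t ∈ Icc 0 (len e), dist (γ e s) (γ e t) = |s - t|
  zero_mem : ∀ e, γ e 0 ∈ V
  len_mem : ∀ e, γ e (len e) ∈ V
  isOpen : ∀ e, IsOpen (γ e '' Ioo 0 (len e))
  notMem : ∀ e, ∀ t ∈ Ioo 0 (len e), γ e t ∉ V
  disjoint : ∀ e e', e ≠ e' → Disjoint (γ e '' Ioo 0 (len e)) (γ e' '' Ioo 0 (len e'))
  cover : ∀ x, x ∈ V ∨ ∃ e, x ∈ γ e '' Ioo 0 (len e)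

/-- The interior of an edge of a prospective model with vertex set `V`. -/
def IsArc {Γ : Type*} [MetricSpace Γ] (V : Set Γ) (s : Set Γ) : Prop :=
  ∃ (ℓ : ℝ) (γ : ℝ → Γ), 0 < ℓ ∧ s = γ '' Ioo 0 ℓ ∧
    (∀ s ∈ Icc 0 ℓ, ∀ t ∈ Icc 0 ℓ, dist (γ s) (γ t) = |s - t|) ∧ γ 0 ∈ V ∧ γ ℓ ∈ V ∧
    IsOpen (γ '' Ioo 0 ℓ) ∧ ∀ t ∈ Ioo 0 ℓ, γ t ∉ V

theorem continuousOn_of_dist_eq {Γ : Type*} [MetricSpace Γ] {γ : ℝ → Γ} {s : Set ℝ}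
    (h : ∀ x ∈ s, ∀ y ∈ s, dist (γ x) (γ y) = |x - y|) : ContinuousOn γ s := by
  have : LipschitzOnWith 1 γ s := LipschitzOnWith.of_dist_le_mul fun x hx y hy => by
    rw [h x hx y hy, Real.dist_eq]; simp
  exact this.continuousOn

/-- Two arcs that meet are equal: an arc is connected, and any other arc is open and closed in the
complement of the vertex set. -/
theorem IsArc.subset_of_inter {Γ : Type*} [MetricSpace Γ] {V s s' : Set Γ} (hs : IsArc V s)
    (hs' : IsArc V s') (hne : (s ∩ s').Nonempty) : s ⊆ s' := by
  obtain ⟨ℓ, γ, hℓ, rfl, hd, h0, h1, ho, hn⟩ := hs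
  obtain ⟨ℓ', γ', hℓ', rfl, hd', h0', h1', ho', hn'⟩ := hs'
  have hcl : IsClosed (γ' '' Icc 0 ℓ') :=
    (isCompact_Icc.image_of_continuousOn (continuousOn_of_dist_eq hd')).isClosed
  have hconn : IsPreconnected (γ '' Ioo 0 ℓ) :=
    isPreconnected_Ioo.image _ ((continuousOn_of_dist_eq hd).mono Ioo_subset_Icc_self)
  refine hconn.subset_left_of_subset_union ho' hcl.isOpen_compl ?_ ?_ hne
  · exact disjoint_compl_right.mono_left (image_mono Ioo_subset_Icc_self)
  · rintro x ⟨t, ht, rfl⟩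
    by_cases hx : γ t ∈ γ' '' Icc 0 ℓ'
    · left
      obtain ⟨u, hu, hux⟩ := hx
      refine ⟨u, ⟨lt_of_le_of_ne hu.1 ?_, lt_of_le_of_ne hu.2 ?_⟩, hux⟩
      · rintro rfl; exact hn t ht (hux ▸ h0')
      · rintro rfl; exact hn t ht (hux ▸ h1')
    · exact Or.inr hx

theorem IsStarAt.isOpen_leg {Γ : Type*} [MetricSpace Γ] {p : Γ} {n : ℕ} {r : ℝ}
    {leg : Fin n → ℝ → Γ} (h : IsStarAt p n r leg) {ρ : ℝ} (hρr : ρ < r)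
    (hb : ∀ x, dist x p < ρ → x ≠ p → ∃ i, x = leg i (dist x p)) (i : Fin n) {a b : ℝ}
    (ha : 0 ≤ a) (hbρ : b ≤ ρ) : IsOpen (leg i '' Ioo a b) := by
  rw [Metric.isOpen_iff]
  rintro x ⟨s, hs, rfl⟩
  refine ⟨min (s - a) (b - s), lt_min (by linarith [hs.1]) (by linarith [hs.2]), fun y hy => ?_⟩
  have hsr : s ∈ Ico 0 r := ⟨by linarith [hs.1], by linarith [hs.2]⟩
  have hys := Metric.mem_ball.1 hy
  have h1 : dist y (leg i s) < s - a := hys.trans_le (min_le_left _ _)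
  have h2 : dist y (leg i s) < b - s := hys.trans_le (min_le_right _ _)
  have h3 := dist_triangle y (leg i s) p
  have h4 := dist_triangle (leg i s) y p
  rw [dist_comm (leg i s) y] at h4
  rw [h.dist_center i hsr] at h3 h4
  have hya : a < dist y p := by linarith
  have hyb : dist y p < b := by linarith
  obtain ⟨j, hj⟩ := hb y (by linarith) (fun he => by rw [he, dist_self] at hya; linarith)
  by_cases hij : j = i
  · subst hij; exact ⟨dist y p, ⟨hya, hyb⟩, hj.symm⟩
  · exfalso
    have := h.dist_ne j i hij (dist y p) ⟨by linarith, by linarith⟩ s hsr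
    rw [← hj] at this
    linarith

/-- Every metric graph has an edge model whose vertex set contains a given finite set. The vertices
are the given points, the centres of finitely many small stars that cover `Γ`, and the ends of the
legs of these stars; every edge is then a piece of a leg. -/
theorem exists_edgeModel {Γ : Type*} [MetricSpace Γ] (hΓ : IsMetricGraph Γ) (F : Finset Γ) :
    ∃ M : EdgeModel Γ, F ⊆ M.V := by
  classical
  have := hΓ.compact
  choose n r leg hstar using hΓ.star
  choose ρ hρ hρr hb using fun p => (hstar p).exists_ball
  obtain ⟨P, hP⟩ := isCompact_univ.elim_finite_subcover (fun p : Γ => Metric.ball p (ρ p))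
    (fun p => Metric.isOpen_ball) (fun x _ => mem_iUnion.2 ⟨x, Metric.mem_ball_self (hρ x)⟩)
  set V : Finset Γ := F ∪ P ∪ P.biUnion (fun p => Finset.univ.image fun i => leg p i (ρ p)) with hV
  have hPV : ∀ p ∈ P, p ∈ V := fun p hp => by simp [hV, hp]
  have hlegV : ∀ p ∈ P, ∀ i, leg p i (ρ p) ∈ V := fun p hp i => by
    simp only [hV, Finset.mem_union, Finset.mem_biUnion, Finset.mem_image, Finset.mem_univ,
      true_and]
    exact Or.inr ⟨p, hp, i, rfl⟩
  -- every point outside `V` lies on an arc cut out of a leg by two consecutive vertices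
  have harc : ∀ x ∉ V, ∃ p ∈ P, ∃ i, ∃ v ∈ V, ∃ w ∈ V,
      x ∈ leg p i '' Ioo (dist v p) (dist w p) ∧
      IsArc (V : Set Γ) (leg p i '' Ioo (dist v p) (dist w p)) := by
    intro x hx
    obtain ⟨p, hp, hxp⟩ := mem_iUnion₂.1 (hP (mem_univ x))
    rw [Metric.mem_ball] at hxp
    have hne : x ≠ p := fun h => hx (h ▸ hPV p hp)
    obtain ⟨i, hi⟩ := hb p x hxp hne
    set s := dist x p with hs
    have hs0 : 0 < s := dist_pos.2 hne
    set T : Finset ℝ := (V.image fun v => dist v p).filter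
      (fun t => 0 ≤ t ∧ t ≤ ρ p ∧ leg p i t ∈ V) with hT
    have hTmem : ∀ t, t ∈ T ↔ 0 ≤ t ∧ t ≤ ρ p ∧ leg p i t ∈ V := by
      intro t
      simp only [hT, Finset.mem_filter, Finset.mem_image, and_iff_right_iff_imp]
      rintro ⟨h0, h1, h2⟩
      exact ⟨_, h2, (hstar p).dist_center i ⟨h0, h1.trans_lt (hρr p)⟩⟩
    have h0T : (0 : ℝ) ∈ T.filter (· < s) := Finset.mem_filter.2
      ⟨(hTmem 0).2 ⟨le_rfl, (hρ p).le, by rw [(hstar p).center]; exact hPV p hp⟩, hs0⟩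
    have hρT : ρ p ∈ T.filter (s < ·) := Finset.mem_filter.2
      ⟨(hTmem _).2 ⟨(hρ p).le, le_rfl, hlegV p hp i⟩, hxp⟩
    set a := (T.filter (· < s)).max' ⟨_, h0T⟩ with ha
    set b := (T.filter (s < ·)).min' ⟨_, hρT⟩ with hbdef
    have haT := Finset.mem_filter.1 ((T.filter (· < s)).max'_mem ⟨_, h0T⟩)
    have hbT := Finset.mem_filter.1 ((T.filter (s < ·)).min'_mem ⟨_, hρT⟩)
    rw [← ha] at haT
    rw [← hbdef] at hbT
    obtain ⟨haT, has⟩ := haT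
    obtain ⟨hbT, hbs⟩ := hbT
    rw [hTmem] at haT hbT
    have hda : dist (leg p i a) p = a :=
      (hstar p).dist_center i ⟨haT.1, haT.2.1.trans_lt (hρr p)⟩
    have hdb : dist (leg p i b) p = b :=
      (hstar p).dist_center i ⟨hbT.1, hbT.2.1.trans_lt (hρr p)⟩
    have himg : (fun τ => leg p i (a + τ)) '' Ioo 0 (b - a) = leg p i '' Ioo a b := by
      ext y
      constructor
      · rintro ⟨τ, hτ, rfl⟩
        exact ⟨a + τ, ⟨by linarith [hτ.1], by linarith [hτ.2]⟩, rfl⟩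
      · rintro ⟨t, ht, rfl⟩
        exact ⟨t - a, ⟨by linarith [ht.1], by linarith [ht.2]⟩, by simp⟩
    refine ⟨p, hp, i, _, haT.2.2, _, hbT.2.2, ?_, ?_⟩ <;> rw [hda, hdb]
    · exact ⟨s, ⟨has, hbs⟩, hi.symm⟩
    · refine ⟨b - a, fun τ => leg p i (a + τ), by linarith, himg.symm, ?_, by simpa using haT.2.2,
        by simpa using hbT.2.2, ?_, ?_⟩
      · intro u hu w hw
        have hr := hρr p
        rw [(hstar p).dist_same i _ ⟨by linarith [hu.1, haT.1], by linarith [hu.2, hbT.2.1]⟩ _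
          ⟨by linarith [hw.1, haT.1], by linarith [hw.2, hbT.2.1]⟩]
        congr 1; ring
      · rw [himg]
        exact (hstar p).isOpen_leg (hρr p) (hb p) i haT.1 hbT.2.1
      · intro τ hτ hmem
        have htT : a + τ ∈ T := (hTmem _).2
          ⟨by linarith [hτ.1, haT.1], by linarith [hτ.2, hbT.2.1], hmem⟩
        rcases lt_trichotomy (a + τ) s with h | h | h
        · have := (T.filter (· < s)).le_max' _ (Finset.mem_filter.2 ⟨htT, h⟩)
          rw [← ha] at this
          linarith [hτ.1]
        · simp only [h, ← hi] at hmem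
          exact hx hmem
        · have := (T.filter (s < ·)).min'_le _ (Finset.mem_filter.2 ⟨htT, h⟩)
          rw [← hbdef] at this
          linarith [hτ.2]
  have hfin : {s : Set Γ | s.Nonempty ∧ IsArc (V : Set Γ) s}.Finite := by
    have hR : (Set.range fun z : (Σ p : P, Fin (n p)) × V × V =>
        leg z.1.1 z.1.2 '' Ioo (dist (z.2.1 : Γ) z.1.1) (dist (z.2.2 : Γ) z.1.1)).Finite :=
      Set.finite_range _
    refine hR.subset ?_
    rintro s ⟨⟨x, hx⟩, hs⟩
    have hxV : x ∉ V := by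
      obtain ⟨ℓ, γ, -, rfl, -, -, -, -, hn⟩ := id hs
      obtain ⟨t, ht, rfl⟩ := hx
      exact hn t ht
    obtain ⟨p, hp, i, v, hv, w, hw, hxm, hA⟩ := harc x hxV
    exact ⟨⟨⟨⟨p, hp⟩, i⟩, ⟨v, hv⟩, ⟨w, hw⟩⟩, Subset.antisymm
      (hA.subset_of_inter hs ⟨x, hxm, hx⟩) (hs.subset_of_inter hA ⟨x, hx, hxm⟩)⟩
  have := hfin.to_subtype
  obtain ⟨N, ⟨φ⟩⟩ := Finite.exists_equiv_fin {s : Set Γ | s.Nonempty ∧ IsArc (V : Set Γ) s}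
  choose ℓ γ h1 h2 h3 h4 h5 h6 h7 using fun e : Fin N => (φ.symm e).2.2
  refine ⟨⟨V, N, ℓ, γ, h1, h3, h4, h5, h6, h7, ?_, ?_⟩, fun x hx => by simp [hV, hx]⟩
  · intro e e' hne
    rw [Set.disjoint_iff_inter_eq_empty, ← Set.not_nonempty_iff_eq_empty]
    intro hmeet
    rw [← h2, ← h2] at hmeet
    have hmeet' := hmeet
    rw [inter_comm] at hmeet'
    apply hne
    apply φ.symm.injective
    exact Subtype.ext (Subset.antisymm
      ((φ.symm e).2.2.subset_of_inter (φ.symm e').2.2 hmeet)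
      ((φ.symm e').2.2.subset_of_inter (φ.symm e).2.2 hmeet'))
  · intro x
    by_cases hx : x ∈ V
    · exact Or.inl hx
    · obtain ⟨p, hp, i, v, hv, w, hw, hxm, hA⟩ := harc x hx
      refine Or.inr ⟨φ ⟨_, ⟨x, hxm⟩, hA⟩, ?_⟩
      rw [← h2]
      simpa using hxm

namespace EdgeModel

variable {Γ : Type*} [MetricSpace Γ] (M : EdgeModel Γ)

/-! ### Arcs and directions of an edge model -/

/-- The closed edge. -/
def arc (e : Fin M.n) : Set Γ := M.γ e '' Icc 0 (M.len e)

/-- The open edge. -/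
def inner (e : Fin M.n) : Set Γ := M.γ e '' Ioo 0 (M.len e)

theorem continuousOn_γ (e : Fin M.n) : ContinuousOn (M.γ e) (Icc 0 (M.len e)) :=
  continuousOn_of_dist_eq (M.dist_eq e)

theorem isClosed_arc (e : Fin M.n) : IsClosed (M.arc e) :=
  (isCompact_Icc.image_of_continuousOn (M.continuousOn_γ e)).isClosed

theorem left_mem (e : Fin M.n) : (0 : ℝ) ∈ Icc 0 (M.len e) := ⟨le_rfl, (M.len_pos e).le⟩

theorem right_mem (e : Fin M.n) : M.len e ∈ Icc 0 (M.len e) := ⟨(M.len_pos e).le, le_rfl⟩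

theorem inner_subset_arc (e : Fin M.n) : M.inner e ⊆ M.arc e := image_mono Ioo_subset_Icc_self

theorem injOn (e : Fin M.n) {s t : ℝ} (hs : s ∈ Icc 0 (M.len e)) (ht : t ∈ Icc 0 (M.len e))
    (h : M.γ e s = M.γ e t) : s = t := by
  have := M.dist_eq e s hs t ht
  rw [h, dist_self] at this
  linarith [abs_eq_zero.1 this.symm]

theorem dist_zero (e : Fin M.n) {t : ℝ} (ht : t ∈ Icc 0 (M.len e)) :
    dist (M.γ e t) (M.γ e 0) = t := by
  rw [M.dist_eq e t ht 0 (M.left_mem e), sub_zero, abs_of_nonneg ht.1]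

/-- A point of an edge that is a vertex is one of the two ends. -/
theorem eq_end_of_mem (e : Fin M.n) {t : ℝ} (ht : t ∈ Icc 0 (M.len e)) (h : M.γ e t ∈ M.V) :
    t = 0 ∨ t = M.len e := by
  by_contra! hne
  exact M.notMem e t ⟨lt_of_le_of_ne ht.1 (Ne.symm hne.1), lt_of_le_of_ne ht.2 hne.2⟩ h

/-- Two edges meet in their interior only if they are equal. -/
theorem eq_of_inner (e e' : Fin M.n) {s t : ℝ} (hs : s ∈ Ioo 0 (M.len e))
    (ht : t ∈ Icc 0 (M.len e')) (h : M.γ e s = M.γ e' t) : e = e' ∧ s = t := by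
  have hV := M.notMem e s hs
  have ht' : t ∈ Ioo 0 (M.len e') := by
    refine ⟨lt_of_le_of_ne ht.1 ?_, lt_of_le_of_ne ht.2 ?_⟩
    · rintro rfl; exact hV (h ▸ M.zero_mem e')
    · rintro rfl; exact hV (h ▸ M.len_mem e')
  by_cases hee : e = e'
  · subst hee; exact ⟨rfl, M.injOn e (Ioo_subset_Icc_self hs) ht h⟩
  · exact absurd ⟨t, ht', h.symm⟩ (Set.disjoint_left.1 (M.disjoint e e' hee) ⟨s, hs, rfl⟩)

/-- The parameter of the point `p` on the edge `e`, provided that `p` lies on it. -/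
def param (e : Fin M.n) (p : Γ) : ℝ := dist p (M.γ e 0)

/-- A direction at a point is an edge with a sign, `true` for increasing parameter. -/
abbrev Direction := Fin M.n × Bool

/-- The sign of a direction. -/
def sgn (b : Bool) : ℝ := if b then 1 else -1

/-- The direction `d` exists at `p`: the point `p` lies on the edge, and is not the end towards
which the direction points. -/
def IsDir (p : Γ) (d : M.Direction) : Prop :=
  ∃ t ∈ Icc 0 (M.len d.1), p = M.γ d.1 t ∧ (d.2 = true → t < M.len d.1) ∧ (d.2 = false → 0 < t)

open Classical in
/-- The directions at `p`. -/
def dirs (p : Γ) : Finset M.Direction := Finset.univ.filter (M.IsDir p)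

theorem mem_dirs {p : Γ} {d : M.Direction} : d ∈ M.dirs p ↔ M.IsDir p d := by
  simp [dirs]

/-- The geodesic that leaves `p` in the direction `d`. -/
def ray (p : Γ) (d : M.Direction) (s : ℝ) : Γ := M.γ d.1 (M.param d.1 p + sgn d.2 * s)

theorem param_γ {e : Fin M.n} {t : ℝ} (ht : t ∈ Icc 0 (M.len e)) : M.param e (M.γ e t) = t :=
  M.dist_zero e ht

/-- The distance from `p` to the end of its edge in the direction `d`. -/
def room (p : Γ) (d : M.Direction) : ℝ :=
  if d.2 then M.len d.1 - M.param d.1 p else M.param d.1 p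

theorem IsDir.room_pos {p : Γ} {d : M.Direction} (h : M.IsDir p d) : 0 < M.room p d := by
  obtain ⟨t, ht, rfl, h1, h2⟩ := h
  unfold room
  rw [M.param_γ ht]
  rcases hd : d.2 with _ | _
  · simpa using h2 hd
  · simpa using h1 hd

theorem IsDir.mem_Icc {p : Γ} {d : M.Direction} (h : M.IsDir p d) {s : ℝ} (hs : 0 ≤ s)
    (hs' : s ≤ M.room p d) : M.param d.1 p + sgn d.2 * s ∈ Icc 0 (M.len d.1) := by
  obtain ⟨t, ht, rfl, h1, h2⟩ := h
  unfold room at hs'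
  rw [M.param_γ ht] at hs' ⊢
  unfold sgn
  rcases hd : d.2 with _ | _ <;> simp only [hd, if_true] at hs' ⊢ <;> simp at hs' ⊢ <;>
    constructor <;> linarith [ht.1, ht.2]

theorem abs_sgn (b : Bool) : |sgn b| = 1 := by unfold sgn; cases b <;> simp

theorem IsDir.ray_zero {p : Γ} {d : M.Direction} (h : M.IsDir p d) : M.ray p d 0 = p := by
  obtain ⟨t, ht, rfl, -, -⟩ := h
  simp [ray, M.param_γ ht]

theorem IsDir.dist_ray {p : Γ} {d : M.Direction} (h : M.IsDir p d) {s t : ℝ} (hs : 0 ≤ s)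
    (hs' : s ≤ M.room p d) (ht : 0 ≤ t) (ht' : t ≤ M.room p d) :
    dist (M.ray p d s) (M.ray p d t) = |s - t| := by
  unfold ray
  rw [M.dist_eq _ _ (h.mem_Icc M hs hs') _ (h.mem_Icc M ht ht')]
  rw [show M.param d.1 p + sgn d.2 * s - (M.param d.1 p + sgn d.2 * t) = sgn d.2 * (s - t) by ring,
    abs_mul, abs_sgn, one_mul]

theorem IsDir.isGerm {p : Γ} {d : M.Direction} (h : M.IsDir p d) :
    IsGerm (M.ray p d) p (M.room p d) where
  pos := h.room_pos M
  zero := h.ray_zero M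
  dist_eq _ hs _ ht := h.dist_ray M hs.1 hs.2.le ht.1 ht.2.le

/-- Distinct directions at a point have rays that separate at once. -/
theorem eq_of_ray_eq {p : Γ} {d d' : M.Direction} (h : M.IsDir p d) (h' : M.IsDir p d') {s : ℝ}
    (hs : 0 < s) (hs1 : s < M.room p d) (hs2 : s < M.room p d') (he : M.ray p d s = M.ray p d' s) :
    d = d' := by
  obtain ⟨e, b⟩ := d
  obtain ⟨e', b'⟩ := d'
  have hm := h'.mem_Icc M hs.le hs2.le
  have hm0 : M.param e p + sgn b * s ∈ Ioo 0 (M.len e) := by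
    obtain ⟨t, ht, rfl, -, -⟩ := h
    unfold room at hs1
    rw [M.param_γ ht] at hs1 ⊢
    unfold sgn
    rcases b with _ | _ <;> simp at hs1 ⊢ <;> constructor <;> linarith [ht.1, ht.2]
  obtain ⟨h1, h2⟩ := M.eq_of_inner e e' hm0 hm he
  subst h1
  have : sgn b = sgn b' := by
    have : sgn b * s = sgn b' * s := by simpa using h2
    exact mul_right_cancel₀ hs.ne' this
  rcases b with _ | _ <;> rcases b' with _ | _ <;> simp [sgn] at this ⊢ <;> linarith

/-- Every point near `p` lies on a ray that leaves `p`. -/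
theorem exists_ray (p : Γ) : ∃ ρ > 0, ∀ x, dist x p < ρ → x ≠ p →
    ∃ d, M.IsDir p d ∧ dist x p ≤ M.room p d ∧ x = M.ray p d (dist x p) := by
  classical
  set K : Set Γ := (⋃ e ∈ {e | p ∉ M.arc e}, M.arc e) ∪ ((M.V : Set Γ) \ {p}) with hK
  have hKc : IsClosed K := by
    refine IsClosed.union ((Set.toFinite _).isClosed_biUnion fun e _ => M.isClosed_arc e) ?_
    exact (M.V.finite_toSet.subset sdiff_subset).isClosed
  have hpK : p ∉ K := by
    rintro (h | h)
    · obtain ⟨e, he, hpe⟩ := mem_iUnion₂.1 h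
      exact he hpe
    · exact h.2 rfl
  obtain ⟨ρ, hρ, hb⟩ := Metric.isOpen_iff.1 hKc.isOpen_compl p hpK
  refine ⟨ρ, hρ, fun x hx hxp => ?_⟩
  have hxK := hb (Metric.mem_ball.2 hx)
  rcases M.cover x with hxV | ⟨e, t', ht'o, rfl⟩
  · exact absurd (Or.inr ⟨hxV, hxp⟩) hxK
  · have ht' := Ioo_subset_Icc_self ht'o
    have hpe : p ∈ M.arc e := by
      by_contra hpe
      exact hxK (Or.inl (mem_iUnion₂.2 ⟨e, hpe, ⟨t', ht', rfl⟩⟩))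
    obtain ⟨t, ht, rfl⟩ := hpe
    have hne : t' ≠ t := fun h => hxp (by rw [h])
    rw [M.dist_eq e t' ht' t ht]
    rcases lt_or_gt_of_ne hne with hlt | hlt
    · refine ⟨(e, false), ⟨t, ht, rfl, by simp, fun _ => by linarith [ht'.1]⟩, ?_, ?_⟩
      · simp only [room, M.param_γ ht, abs_of_neg (sub_neg.2 hlt)]
        simp; exact ht'.1
      · simp only [ray, M.param_γ ht, sgn, abs_of_neg (sub_neg.2 hlt)]
        simp
    · refine ⟨(e, true), ⟨t, ht, rfl, fun _ => by dsimp only; linarith [ht'.2], by simp⟩, ?_, ?_⟩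
      · simp only [room, M.param_γ ht, abs_of_pos (sub_pos.2 hlt)]
        simp; exact ht'.2
      · simp only [ray, M.param_γ ht, sgn, abs_of_pos (sub_pos.2 hlt)]
        simp

/-- The legs of any star at `p` are, near `p`, the rays in the directions at `p`. -/
theorem exists_equiv_legs {p : Γ} {n : ℕ} {r : ℝ} {leg : Fin n → ℝ → Γ}
    (h : IsStarAt p n r leg) :
    ∃ k : {d // d ∈ M.dirs p} ≃ Fin n, ∃ δ > 0, ∀ d, ∀ s ∈ Ico 0 δ,
      leg (k d) s = M.ray p d s ∧ s < M.room p d := by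
  have hd : ∀ d : {d // d ∈ M.dirs p}, M.IsDir p d := fun d => M.mem_dirs.1 d.2
  choose k δ hδ hk using fun d => ((hd d).isGerm M).eq_leg h
  -- a common radius for all directions
  obtain ⟨δ₀, hδ₀, hmin⟩ : ∃ δ₀ > 0, ∀ d, δ₀ ≤ δ d ∧ δ₀ ≤ M.room p d := by
    have hfin : ∀ S : Finset {d // d ∈ M.dirs p}, ∃ δ₀ > 0, ∀ d ∈ S, δ₀ ≤ δ d ∧ δ₀ ≤ M.room p d := by
      intro S
      classical
      induction S using Finset.induction_on with
      | empty => exact ⟨1, one_pos, by simp⟩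
      | insert a S _ ih =>
        obtain ⟨c, hc, hcS⟩ := ih
        refine ⟨min c (min (δ a) (M.room p a)),
          lt_min hc (lt_min (hδ a) ((hd a).room_pos M)), fun d hdS => ?_⟩
        rcases Finset.mem_insert.1 hdS with rfl | hdS
        · exact ⟨(min_le_right _ _).trans (min_le_left _ _),
            (min_le_right _ _).trans (min_le_right _ _)⟩
        · exact ⟨(min_le_left _ _).trans (hcS d hdS).1, (min_le_left _ _).trans (hcS d hdS).2⟩
    obtain ⟨c, hc, h⟩ := hfin Finset.univ
    exact ⟨c, hc, fun d => h d (Finset.mem_univ d)⟩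
  have hbij : Function.Bijective k := by
    constructor
    · intro d d' hdd
      have hm := hmin d
      have hm' := hmin d'
      apply Subtype.ext
      refine M.eq_of_ray_eq (hd d) (hd d') (s := δ₀ / 2) (by linarith) (by linarith) (by linarith) ?_
      rw [hk d _ ⟨by linarith, by linarith⟩, hk d' _ ⟨by linarith, by linarith⟩, hdd]
    · intro i
      obtain ⟨ρ, hρ, hray⟩ := M.exists_ray p
      have hr := h.pos
      have hm : 0 < min δ₀ (min ρ r) := lt_min hδ₀ (lt_min hρ hr)
      have hm1 : min δ₀ (min ρ r) ≤ δ₀ := min_le_left _ _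
      have hm2 : min δ₀ (min ρ r) ≤ ρ := (min_le_right _ _).trans (min_le_left _ _)
      have hm3 : min δ₀ (min ρ r) ≤ r := (min_le_right _ _).trans (min_le_right _ _)
      set s := min δ₀ (min ρ r) / 2 with hs
      have hsr : s ∈ Ico 0 r := ⟨by linarith, by linarith⟩
      have hdist := h.dist_center i hsr
      obtain ⟨d, hdd, -, hx⟩ := hray (leg i s) (by rw [hdist]; linarith)
        (fun he => by rw [he, dist_self] at hdist; linarith)
      rw [hdist] at hx
      refine ⟨⟨d, M.mem_dirs.2 hdd⟩, ?_⟩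
      by_contra hne
      have h1 := hk ⟨d, M.mem_dirs.2 hdd⟩ s
        ⟨hsr.1, by linarith [(hmin ⟨d, M.mem_dirs.2 hdd⟩).1]⟩
      have h2 := h.dist_ne _ i hne s hsr s hsr
      rw [← h1, hx, dist_self] at h2
      linarith
  refine ⟨Equiv.ofBijective k hbij, δ₀, hδ₀, fun d s hs => ⟨?_, hs.2.trans_le (hmin d).2⟩⟩
  exact (hk d s ⟨hs.1, hs.2.trans_le (hmin d).1⟩).symm

theorem dirs_inner {e : Fin M.n} {t : ℝ} (ht : t ∈ Ioo 0 (M.len e)) [DecidableEq M.Direction] :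
    M.dirs (M.γ e t) = {(e, true), (e, false)} := by
  ext d
  rw [mem_dirs]
  constructor
  · rintro ⟨u, hu, hp, -, -⟩
    obtain ⟨h1, -⟩ := M.eq_of_inner e d.1 ht hu hp
    obtain ⟨e', b⟩ := d
    simp only at h1
    subst h1
    cases b <;> simp
  · intro hd
    simp only [Finset.mem_insert, Finset.mem_singleton] at hd
    rcases hd with rfl | rfl
    · exact ⟨t, Ioo_subset_Icc_self ht, rfl, fun _ => ht.2, by simp⟩
    · exact ⟨t, Ioo_subset_Icc_self ht, rfl, by simp, fun _ => ht.1⟩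

/-- Points in the interior of an edge have valency `2`. -/
theorem valency_inner {e : Fin M.n} {t : ℝ} (ht : t ∈ Ioo 0 (M.len e)) {n : ℕ}
    (h : HasValency (M.γ e t) n) : n = 2 := by
  classical
  obtain ⟨r, leg, hs⟩ := h
  obtain ⟨k, -⟩ := M.exists_equiv_legs hs
  have h2 := Fintype.card_congr k
  rw [Fintype.card_coe, M.dirs_inner ht, Fintype.card_fin] at h2
  rw [← h2]
  exact Finset.card_pair (by simp)

theorem inner_subset_compl (e : Fin M.n) : M.inner e ⊆ (branchPoints Γ)ᶜ := by
  rintro _ ⟨t, ht, rfl⟩ ⟨n, hn, hv⟩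
  exact hn (M.valency_inner ht hv)

/-- The open edges of a model are open edge segments. -/
theorem isOpenEdgeSegment_inner (e : Fin M.n) : IsOpenEdgeSegment (M.inner e) := by
  have hl := M.len_pos e
  have hconn : IsConnected (M.inner e) :=
    (isConnected_Ioo hl).image _ ((M.continuousOn_γ e).mono Ioo_subset_Icc_self)
  obtain ⟨x, hx⟩ := hconn.nonempty
  exact ⟨M.isOpen e, hconn, _, ⟨x, M.inner_subset_compl e hx, rfl⟩,
    hconn.isPreconnected.subset_connectedComponentIn hx (M.inner_subset_compl e)⟩

theorem arc_subset_closure (e : Fin M.n) : M.arc e ⊆ closure (M.inner e) := by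
  rintro _ ⟨t, ht, rfl⟩
  have h1 : t ∈ closure (Ioo 0 (M.len e)) := by rwa [closure_Ioo (M.len_pos e).ne]
  have h2 : ContinuousWithinAt (M.γ e) (Ioo 0 (M.len e)) t :=
    ((M.continuousOn_γ e) t ht).mono Ioo_subset_Icc_self
  exact h2.mem_closure_image h1

/-! ### Gluing functions along the edges -/

theorem cover_arc (x : Γ) : x ∈ M.V ∨ ∃ e, x ∈ M.arc e :=
  (M.cover x).imp_right fun ⟨e, h⟩ => ⟨e, M.inner_subset_arc e h⟩

theorem continuous_of_arcs {Y : Type*} [TopologicalSpace Y] {f : Γ → Y}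
    (h : ∀ e, ContinuousOn f (M.arc e)) : Continuous f := by
  let C : Option (Fin M.n) → Set Γ := fun o => o.elim (M.V : Set Γ) M.arc
  refine (locallyFinite_of_finite C).continuous ?_ ?_ ?_
  · rw [eq_univ_iff_forall]
    intro x
    rcases M.cover_arc x with h | ⟨e, h⟩
    · exact mem_iUnion.2 ⟨none, h⟩
    · exact mem_iUnion.2 ⟨some e, h⟩
  · rintro (_ | e)
    · exact M.V.finite_toSet.isClosed
    · exact M.isClosed_arc e
  · rintro (_ | e)
    · exact M.V.finite_toSet.continuousOn f
    · exact h e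

/-- Continuous functions on the edges that agree with given values at the vertices glue to a
continuous function. -/
theorem exists_glue {Y : Type*} [TopologicalSpace Y] (h : Γ → Y) (F : Fin M.n → ℝ → Y)
    (hF : ∀ e, Continuous (F e)) (h0 : ∀ e, F e 0 = h (M.γ e 0))
    (h1 : ∀ e, F e (M.len e) = h (M.γ e (M.len e))) :
    ∃ f : Γ → Y, Continuous f ∧ (∀ v ∈ M.V, f v = h v) ∧
      ∀ e, ∀ t ∈ Icc 0 (M.len e), f (M.γ e t) = F e t := by
  classical
  let f : Γ → Y := fun x => if hx : ∃ e, x ∈ M.inner e then F hx.choose (M.param hx.choose x)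
    else h x
  have hV : ∀ v ∈ M.V, f v = h v := by
    intro v hv
    have : ¬ ∃ e, v ∈ M.inner e := by
      rintro ⟨e, t, ht, rfl⟩
      exact M.notMem e t ht hv
    simp only [f, dif_neg this]
  have hE : ∀ e, ∀ t ∈ Icc 0 (M.len e), f (M.γ e t) = F e t := by
    intro e t ht
    by_cases hv : M.γ e t ∈ M.V
    · rw [hV _ hv]
      rcases M.eq_end_of_mem e ht hv with rfl | rfl
      · rw [h0]
      · rw [h1]
    · have hto : t ∈ Ioo 0 (M.len e) := by
        refine ⟨lt_of_le_of_ne ht.1 ?_, lt_of_le_of_ne ht.2 ?_⟩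
        · rintro rfl; exact hv (M.zero_mem e)
        · rintro rfl; exact hv (M.len_mem e)
      have hx : ∃ e', M.γ e t ∈ M.inner e' := ⟨e, t, hto, rfl⟩
      simp only [f, dif_pos hx]
      obtain ⟨u, hu, hux⟩ := hx.choose_spec
      obtain ⟨h2, -⟩ := M.eq_of_inner e hx.choose hto (Ioo_subset_Icc_self hu) hux.symm
      rw [← h2, M.param_γ ht]
  refine ⟨f, M.continuous_of_arcs fun e => ?_, hV, hE⟩
  have : ContinuousOn (fun x => F e (M.param e x)) (M.arc e) :=
    ((hF e).comp (continuous_id.dist continuous_const)).continuousOn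
  refine this.congr ?_
  rintro _ ⟨t, ht, rfl⟩
  simp only [hE e t ht, M.param_γ ht]

end EdgeModel

/-! ### Principal divisors -/

/-- `Δ` is the divisor of the rational function `φ`, computed in every star (and not just in some
star) at every point. -/
structure IsPrincipal {Γ : Type*} [MetricSpace Γ] (φ : Γ → ℝ) (Δ : Γ →₀ ℤ) : Prop where
  rational : IsRational φ
  slopes : ∀ (p : Γ) (n : ℕ) (r : ℝ) (leg : Fin n → ℝ → Γ), IsStarAt p n r leg →
    ∃ m : Fin n → ℤ, (∀ i, HasDerivWithinAt (fun t => φ (leg i t)) (m i : ℝ) (Ici 0) 0) ∧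
      Δ p = ∑ i, -m i

theorem IsRational.add {Γ : Type*} [MetricSpace Γ] {φ ψ : Γ → ℝ} (h : IsRational φ)
    (h' : IsRational ψ) : IsRational (fun x => φ x + ψ x) where
  continuous := h.continuous.add h'.continuous
  piecewise ε hε γ hγ := by
    classical
    obtain ⟨s, hs⟩ := h.piecewise ε hε γ hγ
    obtain ⟨s', hs'⟩ := h'.piecewise ε hε γ hγ
    refine ⟨s ∪ s', fun x y hx hxy hy hd => ?_⟩
    rw [Finset.coe_union, disjoint_union_right] at hd
    obtain ⟨m, hm⟩ := hs x y hx hxy hy hd.1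
    obtain ⟨m', hm'⟩ := hs' x y hx hxy hy hd.2
    refine ⟨m + m', fun t ht => ?_⟩
    simp only [hm t ht, hm' t ht]
    push_cast
    ring

theorem IsPrincipal.add_isDivisorOf {Γ : Type*} [MetricSpace Γ] {φ ψ : Γ → ℝ} {Δ D : Γ →₀ ℤ}
    (h : IsPrincipal φ Δ) (h' : IsDivisorOf ψ D) : IsDivisorOf (fun x => φ x + ψ x) (Δ + D) := by
  intro p
  obtain ⟨n, r, leg, hs, m', hm', hD⟩ := h' p
  obtain ⟨m, hm, hΔ⟩ := h.slopes p n r leg hs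
  refine ⟨n, r, leg, hs, fun i => m i + m' i, fun i => ?_, ?_⟩
  · have := (hm i).add (hm' i)
    push_cast
    exact this
  · rw [Finsupp.add_apply, hΔ, hD, ← Finset.sum_add_distrib]
    exact Finset.sum_congr rfl fun i _ => by ring

theorem IsPrincipal.add {Γ : Type*} [MetricSpace Γ] {φ ψ : Γ → ℝ} {Δ D : Γ →₀ ℤ}
    (h : IsPrincipal φ Δ) (h' : IsPrincipal ψ D) : IsPrincipal (fun x => φ x + ψ x) (Δ + D) where
  rational := h.rational.add h'.rational
  slopes p n r leg hs := by
    obtain ⟨m, hm, hΔ⟩ := h.slopes p n r leg hs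
    obtain ⟨m', hm', hD⟩ := h'.slopes p n r leg hs
    refine ⟨fun i => m i + m' i, fun i => ?_, ?_⟩
    · have := (hm i).add (hm' i)
      push_cast
      exact this
    · rw [Finsupp.add_apply, hΔ, hD, ← Finset.sum_add_distrib]
      exact Finset.sum_congr rfl fun i _ => by ring

theorem IsPrincipal.zero {Γ : Type*} [MetricSpace Γ] :
    IsPrincipal (fun _ : Γ => (0 : ℝ)) 0 where
  rational := ⟨continuous_const, fun _ _ _ _ => ⟨∅, fun _ _ _ _ _ _ => ⟨0, by simp⟩⟩⟩
  slopes _ _ _ _ _ := ⟨fun _ => 0, fun i => by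
    simpa using hasDerivWithinAt_const (0 : ℝ) (Ici (0 : ℝ)) (0 : ℝ), by simp⟩

/-- A function that is affine with an integer slope on a one-sided neighborhood on either side of
every point of `[0, ε]` is piecewise affine. -/
theorem isIntegralPiecewiseAffineOn_of_local {f : ℝ → ℝ} {ε : ℝ} (hε : 0 ≤ ε)
    (hr : ∀ t ∈ Ico 0 ε, ∃ m : ℤ, ∃ δ > 0, ∀ s ∈ Ico 0 δ, t + s ≤ ε → f (t + s) = f t + m * s)
    (hl : ∀ t ∈ Ioc 0 ε, ∃ m : ℤ, ∃ δ > 0, ∀ s ∈ Ico 0 δ, 0 ≤ t - s → f (t - s) = f t + m * s) :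
    IsIntegralPiecewiseAffineOn f ε := by
  classical
  refine interval_induction hε (fun a b => ∃ s : Finset ℝ, ∀ x y, a ≤ x → x ≤ y → y ≤ b →
    Disjoint (Ioo x y) (s : Set ℝ) → ∃ m : ℤ, ∀ t ∈ Icc x y, f t = f x + m * (t - x)) ?_ ?_
  · rintro a b c - hab hbc - ⟨s, hs⟩ ⟨s', hs'⟩
    refine ⟨insert b (s ∪ s'), fun x y hx hxy hy hd => ?_⟩
    rw [Finset.coe_insert, Finset.coe_union, Set.disjoint_insert_right, disjoint_union_right] at hd
    obtain ⟨hb, hd1, hd2⟩ := hd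
    rcases le_or_gt y b with h | h
    · exact hs x y hx hxy h hd1
    · have : b ≤ x := by
        by_contra! hlt
        exact hb ⟨hlt, h⟩
      exact hs' x y this hxy hy hd2
  · intro t ht
    have hR : ∃ m : ℤ, ∃ δ > 0, ∀ s ∈ Ico 0 δ, t + s ≤ ε → f (t + s) = f t + m * s := by
      rcases ht.2.eq_or_lt with rfl | h
      · refine ⟨0, 1, one_pos, fun s hs hse => ?_⟩
        have : s = 0 := le_antisymm (by linarith) hs.1
        simp [this]
      · exact hr t ⟨ht.1, h⟩
    have hL : ∃ m : ℤ, ∃ δ > 0, ∀ s ∈ Ico 0 δ, 0 ≤ t - s → f (t - s) = f t + m * s := by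
      rcases ht.1.eq_or_lt with rfl | h
      · refine ⟨0, 1, one_pos, fun s hs hse => ?_⟩
        have : s = 0 := le_antisymm (by linarith) hs.1
        simp [this]
      · exact hl t ⟨h, ht.2⟩
    obtain ⟨m, δ, hδ, hm⟩ := hR
    obtain ⟨m', δ', hδ', hm'⟩ := hL
    refine ⟨min δ δ', lt_min hδ hδ', fun a b ha hb hta hab htb => ?_⟩
    have e1 := min_le_left δ δ'
    have e2 := min_le_right δ δ'
    have key : ∀ u, a ≤ u → u ≤ b → (t ≤ u → f u = f t + m * (u - t)) ∧
        (u ≤ t → f u = f t + m' * (t - u)) := by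
      intro u hau hub
      constructor
      · intro htu
        have := hm (u - t) ⟨by linarith, by linarith⟩ (by linarith)
        simpa using this
      · intro htu
        have := hm' (t - u) ⟨by linarith, by linarith⟩ (by linarith)
        simpa using this
    refine ⟨{t}, fun x y hx hxy hy hd => ?_⟩
    rw [Finset.coe_singleton, disjoint_singleton_right] at hd
    rcases le_or_gt y t with h | h
    · refine ⟨-m', fun u hu => ?_⟩
      rw [(key u (hx.trans hu.1) (hu.2.trans hy)).2 (hu.2.trans h),
        (key x hx (hxy.trans hy)).2 (hxy.trans h)]
      push_cast; ring
    · have htx : t ≤ x := by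
        by_contra! hlt
        exact hd ⟨hlt, h⟩
      refine ⟨m, fun u hu => ?_⟩
      rw [(key u (hx.trans hu.1) (hu.2.trans hy)).1 (htx.trans hu.1),
        (key x hx (hxy.trans hy)).1 htx]
      ring

/-- Conversely, a piecewise affine function is affine near every point, on either side. -/
theorem IsIntegralPiecewiseAffineOn.exists_local {f : ℝ → ℝ} {ε : ℝ}
    (h : IsIntegralPiecewiseAffineOn f ε) (t : ℝ) :
    ∃ δ > 0, (t ∈ Ico 0 ε → ∃ m : ℤ, ∀ s ∈ Ico 0 δ, f (t + s) = f t + m * s) ∧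
      (t ∈ Ioc 0 ε → ∃ m : ℤ, ∀ s ∈ Ico 0 δ, f (t - s) = f t + m * s) := by
  classical
  obtain ⟨S, hS⟩ := h
  have hc : IsClosed ((S.erase t : Finset ℝ) : Set ℝ) := (S.erase t).finite_toSet.isClosed
  obtain ⟨ρ, hρ, hb⟩ := Metric.isOpen_iff.1 hc.isOpen_compl t (by simp)
  have hfree : ∀ u ∈ S, |u - t| < ρ → u = t := by
    intro u hu hut
    by_contra hne
    exact hb (Metric.mem_ball.2 (by rwa [Real.dist_eq])) (by simp [hu, hne])
  set δ := min ρ (min (if t < ε then ε - t else 1) (if 0 < t then t else 1)) with hδ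
  have hδ1 : δ ≤ ρ := min_le_left _ _
  have hδ2 : δ ≤ (if t < ε then ε - t else 1) := (min_le_right _ _).trans (min_le_left _ _)
  have hδ3 : δ ≤ (if 0 < t then t else 1) := (min_le_right _ _).trans (min_le_right _ _)
  have hδ0 : 0 < δ := by
    refine lt_min hρ (lt_min ?_ ?_)
    · split_ifs with h
      · linarith
      · exact one_pos
    · split_ifs with h
      · exact h
      · exact one_pos
  refine ⟨δ, hδ0, fun ht => ?_, fun ht => ?_⟩
  · rw [if_pos ht.2] at hδ2
    obtain ⟨m, hm⟩ := hS t (t + δ) ht.1 (by linarith) (by linarith) (by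
      rw [Set.disjoint_left]
      intro u hu huS
      have := hfree u huS (by rw [abs_of_pos (by linarith [hu.1])]; linarith [hu.2])
      linarith [hu.1])
    exact ⟨m, fun s hs => by
      rw [hm (t + s) ⟨by linarith [hs.1], by linarith [hs.2]⟩]; ring⟩
  · rw [if_pos ht.1] at hδ3
    obtain ⟨m, hm⟩ := hS (t - δ) t (by linarith) (by linarith) ht.2 (by
      rw [Set.disjoint_left]
      intro u hu huS
      have := hfree u huS (by rw [abs_of_neg (by linarith [hu.2])]; linarith [hu.1])
      linarith [hu.2])
    exact ⟨-m, fun s hs => by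
      rw [hm (t - s) ⟨by linarith [hs.2], by linarith [hs.1]⟩, hm t ⟨by linarith, le_rfl⟩]
      push_cast; ring⟩

namespace EdgeModel

variable {Γ : Type*} [MetricSpace Γ] (M : EdgeModel Γ)

/-- The function `φ` is affine with slope `m` near `p` in the direction `d`. -/
def HasSlope (φ : Γ → ℝ) (p : Γ) (d : M.Direction) (m : ℤ) : Prop :=
  ∃ δ > 0, ∀ s ∈ Ico 0 δ, φ (M.ray p d s) = φ p + m * s

/-- The slope along a leg of a star is the slope in the corresponding direction. -/
theorem HasSlope.hasDerivWithinAt {φ : Γ → ℝ} {p : Γ} {d : M.Direction} {m : ℤ}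
    (h : M.HasSlope φ p d m) {c : ℝ → Γ} {δ : ℝ} (hδ : 0 < δ)
    (hc : ∀ s ∈ Ico 0 δ, c s = M.ray p d s) :
    HasDerivWithinAt (fun t => φ (c t)) (m : ℝ) (Ici 0) 0 := by
  obtain ⟨δ', hδ', hm⟩ := h
  have h1 : HasDerivWithinAt (fun t : ℝ => φ p + m * t) (m : ℝ) (Ici 0) 0 := by
    simpa using (((hasDerivAt_id (0 : ℝ)).const_mul (m : ℝ)).const_add (φ p)).hasDerivWithinAt
  have hmem : Ico 0 (min δ δ') ∈ 𝓝[Ici 0] (0 : ℝ) := Ico_mem_nhdsGE (lt_min hδ hδ')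
  refine h1.congr_of_eventuallyEq (Filter.eventually_of_mem hmem fun s hs => ?_) ?_
  · simp only [hc s ⟨hs.1, hs.2.trans_le (min_le_left _ _)⟩,
      hm s ⟨hs.1, hs.2.trans_le (min_le_right _ _)⟩]
  · simp only [hc 0 ⟨le_rfl, hδ⟩, hm 0 ⟨le_rfl, hδ'⟩]

/-- A continuous function with integer slopes in all directions is rational, and its divisor is
minus the sum of its slopes over the directions. -/
theorem isPrincipal_of_slopes (hΓ : IsMetricGraph Γ) {φ : Γ → ℝ} (hφ : Continuous φ)
    {m : Γ → M.Direction → ℤ} (hm : ∀ p, ∀ d ∈ M.dirs p, M.HasSlope φ p d (m p d)) {Δ : Γ →₀ ℤ}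
    (hΔ : ∀ p, Δ p = ∑ d ∈ M.dirs p, -m p d) : IsPrincipal φ Δ := by
  have hgerm : ∀ (c : ℝ → Γ) (p : Γ) (δ : ℝ), IsGerm c p δ →
      ∃ k : ℤ, ∃ δ' > 0, ∀ s ∈ Ico 0 δ', φ (c s) = φ p + k * s := by
    intro c p δ hc
    obtain ⟨n, r, leg, hs⟩ := hΓ.star p
    obtain ⟨i, δ₁, hδ₁, h1⟩ := hc.eq_leg hs
    obtain ⟨k, δ₂, hδ₂, h2⟩ := M.exists_equiv_legs hs
    obtain ⟨δ₃, hδ₃, h3⟩ := hm p _ (k.symm i).2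
    refine ⟨m p (k.symm i), min δ₁ (min δ₂ δ₃), lt_min hδ₁ (lt_min hδ₂ hδ₃), fun s hs => ?_⟩
    have e := h2 (k.symm i) s ⟨hs.1, hs.2.trans_le ((min_le_right _ _).trans (min_le_left _ _))⟩
    rw [Equiv.apply_symm_apply] at e
    rw [h1 s ⟨hs.1, hs.2.trans_le (min_le_left _ _)⟩, e.1,
      h3 s ⟨hs.1, hs.2.trans_le ((min_le_right _ _).trans (min_le_right _ _))⟩]
  refine ⟨⟨hφ, fun ε hε γ hγ => isIntegralPiecewiseAffineOn_of_local hε.le ?_ ?_⟩, ?_⟩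
  · intro t ht
    obtain ⟨k, δ, hδ, h⟩ := hgerm (fun s => γ (t + s)) (γ t) (ε - t)
      ⟨by linarith [ht.2], by simp, fun s hs u hu => by
        rw [hγ _ ⟨by linarith [hs.1, ht.1], by linarith [hs.2]⟩ _
          ⟨by linarith [hu.1, ht.1], by linarith [hu.2]⟩]
        congr 1; ring⟩
    exact ⟨k, δ, hδ, fun s hs _ => h s hs⟩
  · intro t ht
    obtain ⟨k, δ, hδ, h⟩ := hgerm (fun s => γ (t - s)) (γ t) t
      ⟨ht.1, by simp, fun s hs u hu => by
        rw [hγ _ ⟨by linarith [hs.2], by linarith [hs.1, ht.2]⟩ _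
          ⟨by linarith [hu.2], by linarith [hu.1, ht.2]⟩, abs_sub_comm]
        congr 1; ring⟩
    exact ⟨k, δ, hδ, fun s hs _ => h s hs⟩
  · intro p n r leg hs
    obtain ⟨k, δ, hδ, hk⟩ := M.exists_equiv_legs hs
    refine ⟨fun i => m p (k.symm i), fun i => ?_, ?_⟩
    · refine (hm p _ (k.symm i).2).hasDerivWithinAt M hδ fun s hs' => ?_
      have := (hk (k.symm i) s hs').1
      rwa [Equiv.apply_symm_apply] at this
    · rw [hΔ, ← Finset.sum_coe_sort, ← Equiv.sum_comp k]
      simp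

/-- The sum of the incoming slopes of a function, in terms of the directions of a model. -/
theorem _root_.TropicalGraph.IncomingSlopeSum.eq_sum_dirs {φ : Γ → ℝ} {p : Γ} {k : ℤ}
    (h : IncomingSlopeSum φ p k) {m : M.Direction → ℤ}
    (hm : ∀ d ∈ M.dirs p, M.HasSlope φ p d (m d)) : k = ∑ d ∈ M.dirs p, -m d := by
  obtain ⟨n, r, leg, hs, m', hm', rfl⟩ := h
  obtain ⟨e, δ, hδ, he⟩ := M.exists_equiv_legs hs
  rw [← Finset.sum_coe_sort (M.dirs p), ← Equiv.sum_comp e]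
  refine Finset.sum_congr rfl fun d _ => ?_
  have h1 := (hm d d.2).hasDerivWithinAt M hδ fun s hs' => (he d s hs').1
  have h2 := (uniqueDiffWithinAt_Ici (0 : ℝ)).eq_deriv _ h1 (hm' (e d))
  rw [Int.cast_injective h2]

theorem isDir_true {p : Γ} {e : Fin M.n} :
    M.IsDir p (e, true) ↔ ∃ t ∈ Ico 0 (M.len e), p = M.γ e t :=
  ⟨fun ⟨t, ht, hp, h, _⟩ => ⟨t, ⟨ht.1, h rfl⟩, hp⟩,
    fun ⟨t, ht, hp⟩ => ⟨t, Ico_subset_Icc_self ht, hp, fun _ => ht.2, by simp⟩⟩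

theorem isDir_false {p : Γ} {e : Fin M.n} :
    M.IsDir p (e, false) ↔ ∃ t ∈ Ioc 0 (M.len e), p = M.γ e t :=
  ⟨fun ⟨t, ht, hp, _, h⟩ => ⟨t, ⟨h rfl, ht.2⟩, hp⟩,
    fun ⟨t, ht, hp⟩ => ⟨t, Ioc_subset_Icc_self ht, hp, by simp, fun _ => ht.1⟩⟩

open Classical in
theorem sum_dirs (p : Γ) (g : M.Direction → ℤ) : ∑ d ∈ M.dirs p, g d =
    ∑ e, ((if M.IsDir p (e, true) then g (e, true) else 0) +
      (if M.IsDir p (e, false) then g (e, false) else 0)) := by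
  rw [dirs, Finset.sum_filter, Fintype.sum_prod_type]
  refine Finset.sum_congr rfl fun e _ => ?_
  rw [Fintype.sum_bool]

/-! ### Firing a set of vertices -/

/-- A continuous function that on every edge `e` is constant up to `lo e`, has slope `sg e` on
`[lo e, hi e]`, and is constant from there on, moves for every edge `sg e` chips from `lo e` to
`hi e`. -/
theorem exists_isPrincipal (hΓ : IsMetricGraph Γ) (h : Γ → ℝ) (base lo hi : Fin M.n → ℝ)
    (sg : Fin M.n → ℤ) (hlo : ∀ e, 0 ≤ lo e) (hlh : ∀ e, lo e ≤ hi e) (hhi : ∀ e, hi e ≤ M.len e)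
    (h0 : ∀ e, base e + sg e * lo e = h (M.γ e 0))
    (h1 : ∀ e, base e + sg e * hi e = h (M.γ e (M.len e))) :
    ∃ φ : Γ → ℝ, IsPrincipal φ
      (∑ e, sg e • (Finsupp.single (M.γ e (hi e)) 1 - Finsupp.single (M.γ e (lo e)) 1)) := by
  classical
  obtain ⟨φ, hφ, -, hφE⟩ := M.exists_glue h
    (fun e t => base e + sg e * max (lo e) (min t (hi e))) (fun e => by fun_prop)
    (fun e => by
      rw [← h0, min_eq_left ((hlo e).trans (hlh e)), max_eq_left (hlo e)])
    (fun e => by rw [← h1, min_eq_right (hhi e), max_eq_right (hlh e)])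
  refine ⟨φ, M.isPrincipal_of_slopes hΓ hφ
    (m := fun p d => if d.2 then (if lo d.1 ≤ M.param d.1 p ∧ M.param d.1 p < hi d.1 then sg d.1
      else 0) else (if lo d.1 < M.param d.1 p ∧ M.param d.1 p ≤ hi d.1 then -sg d.1 else 0)) ?_ ?_⟩
  · rintro p ⟨e, b⟩ hd
    have hdir := M.mem_dirs.1 hd
    have hroom := hdir.room_pos M
    have hray : ∀ s ∈ Ico 0 (M.room p (e, b)), φ (M.ray p (e, b) s) =
        base e + sg e * max (lo e) (min (M.param e p + sgn b * s) (hi e)) := fun s hs => by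
      rw [ray, hφE e _ (hdir.mem_Icc M hs.1 hs.2.le)]
    have hφp : φ p = base e + sg e * max (lo e) (min (M.param e p) (hi e)) := by
      have := hray 0 ⟨le_rfl, hroom⟩
      rwa [hdir.ray_zero M, mul_zero, add_zero] at this
    set τ := M.param e p with hτ
    have hle := hlh e
    rcases b with _ | _
    · -- decreasing parameter
      have hc : ∃ δ > 0, ∀ s ∈ Ico 0 δ, max (lo e) (min (τ - s) (hi e)) =
          max (lo e) (min τ (hi e)) - if lo e < τ ∧ τ ≤ hi e then s else 0 := by
        rcases le_or_gt τ (lo e) with h | h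
        · refine ⟨1, one_pos, fun s hs => ?_⟩
          rw [if_neg (by intro h'; linarith [h'.1]), min_eq_left (by linarith [hs.1]),
            min_eq_left (by linarith), max_eq_left h, max_eq_left (by linarith [hs.1])]
          ring
        · rcases le_or_gt τ (hi e) with h' | h'
          · refine ⟨τ - lo e, by linarith, fun s hs => ?_⟩
            rw [if_pos ⟨h, h'⟩, min_eq_left h', min_eq_left (by linarith [hs.1]),
              max_eq_right h.le, max_eq_right (by linarith [hs.2])]
          · refine ⟨τ - hi e, by linarith, fun s hs => ?_⟩
            rw [if_neg (by intro h''; linarith [h''.2]), min_eq_right h'.le,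
              min_eq_right (by linarith [hs.2])]
            ring
      obtain ⟨δ, hδ, hc⟩ := hc
      refine ⟨min δ (M.room p (e, false)), lt_min hδ hroom, fun s hs => ?_⟩
      rw [hray s ⟨hs.1, hs.2.trans_le (min_le_right _ _)⟩, hφp]
      have := hc s ⟨hs.1, hs.2.trans_le (min_le_left _ _)⟩
      simp only [sgn, Bool.false_eq_true, if_false]
      rw [show τ + -1 * s = τ - s by ring, this]
      split_ifs <;> push_cast <;> ring
    · -- increasing parameter
      have hc : ∃ δ > 0, ∀ s ∈ Ico 0 δ, max (lo e) (min (τ + s) (hi e)) =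
          max (lo e) (min τ (hi e)) + if lo e ≤ τ ∧ τ < hi e then s else 0 := by
        rcases lt_or_ge τ (lo e) with h | h
        · refine ⟨lo e - τ, by linarith, fun s hs => ?_⟩
          rw [if_neg (by intro h'; linarith [h'.1]), min_eq_left (by linarith [hs.2]),
            min_eq_left (by linarith), max_eq_left h.le, max_eq_left (by linarith [hs.2])]
          ring
        · rcases lt_or_ge τ (hi e) with h' | h'
          · refine ⟨hi e - τ, by linarith, fun s hs => ?_⟩
            rw [if_pos ⟨h, h'⟩, min_eq_left h'.le, min_eq_left (by linarith [hs.2]),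
              max_eq_right h, max_eq_right (by linarith [hs.1])]
          · refine ⟨1, one_pos, fun s hs => ?_⟩
            rw [if_neg (by intro h''; linarith [h''.2]), min_eq_right h',
              min_eq_right (by linarith [hs.1])]
            ring
      obtain ⟨δ, hδ, hc⟩ := hc
      refine ⟨min δ (M.room p (e, true)), lt_min hδ hroom, fun s hs => ?_⟩
      rw [hray s ⟨hs.1, hs.2.trans_le (min_le_right _ _)⟩, hφp]
      have := hc s ⟨hs.1, hs.2.trans_le (min_le_left _ _)⟩
      simp only [sgn, if_true]
      rw [one_mul, this]
      split_ifs <;> push_cast <;> ring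
  · intro p
    rw [M.sum_dirs, Finsupp.finsetSum_apply]
    refine Finset.sum_congr rfl fun e _ => ?_
    simp only [Finsupp.smul_apply, Finsupp.sub_apply, Finsupp.single_apply]
    have hhi0 : hi e ∈ Icc 0 (M.len e) := ⟨(hlo e).trans (hlh e), hhi e⟩
    have hlo0 : lo e ∈ Icc 0 (M.len e) := ⟨hlo e, (hlh e).trans (hhi e)⟩
    by_cases hp : p ∈ M.arc e
    · obtain ⟨t, ht, rfl⟩ := hp
      have ht' : M.IsDir (M.γ e t) (e, true) ↔ t < M.len e := by
        rw [isDir_true]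
        refine ⟨?_, fun h => ⟨t, ⟨ht.1, h⟩, rfl⟩⟩
        rintro ⟨u, hu, he⟩
        rw [M.injOn e ht (Ico_subset_Icc_self hu) he]; exact hu.2
      have ht'' : M.IsDir (M.γ e t) (e, false) ↔ 0 < t := by
        rw [isDir_false]
        refine ⟨?_, fun h => ⟨t, ⟨h, ht.2⟩, rfl⟩⟩
        rintro ⟨u, hu, he⟩
        rw [M.injOn e ht (Ioc_subset_Icc_self hu) he]; exact hu.1
      have e1 : (M.γ e (hi e) = M.γ e t) ↔ hi e = t := ⟨M.injOn e hhi0 ht, fun h => by rw [h]⟩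
      have e2 : (M.γ e (lo e) = M.γ e t) ↔ lo e = t := ⟨M.injOn e hlo0 ht, fun h => by rw [h]⟩
      simp only [ht', ht'', e1, e2, M.param_γ ht]
      have hle := hlh e
      have := hhi e
      have := hlo e
      split_ifs <;> first | simp; done | (exfalso; grind)
    · have n1 : ¬ M.IsDir p (e, true) := fun ⟨t, ht, hpt, _⟩ => hp ⟨t, ht, hpt.symm⟩
      have n2 : ¬ M.IsDir p (e, false) := fun ⟨t, ht, hpt, _⟩ => hp ⟨t, ht, hpt.symm⟩
      have n3 : M.γ e (hi e) ≠ p := fun h => hp ⟨_, hhi0, h⟩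
      have n4 : M.γ e (lo e) ≠ p := fun h => hp ⟨_, hlo0, h⟩
      simp [n1, n2, n3, n4]

open Classical in
/-- The edges with exactly one end in `W`. -/
def crossing (W : Set Γ) : Finset (Fin M.n) :=
  Finset.univ.filter fun e => ¬ (M.γ e 0 ∈ W ↔ M.γ e (M.len e) ∈ W)

theorem mem_crossing {W : Set Γ} {e : Fin M.n} :
    e ∈ M.crossing W ↔ ¬ (M.γ e 0 ∈ W ↔ M.γ e (M.len e) ∈ W) := by
  simp [crossing]

/-- Firing a set `W` of vertices: on every edge with one end in `W`, a chip is moved by `t` away from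
`W`, from `a e` to `b e`. -/
theorem exists_isPrincipal_fire (hΓ : IsMetricGraph Γ) (W : Set Γ) (t : ℝ) (ht : 0 ≤ t)
    (a b : Fin M.n → ℝ)
    (hmem : ∀ e ∈ M.crossing W, a e ∈ Icc 0 (M.len e) ∧ b e ∈ Icc 0 (M.len e))
    (hab : ∀ e, M.γ e 0 ∈ W → M.γ e (M.len e) ∉ W → b e = a e + t)
    (hba : ∀ e, M.γ e 0 ∉ W → M.γ e (M.len e) ∈ W → a e = b e + t) :
    ∃ φ : Γ → ℝ, IsPrincipal φ (∑ e ∈ M.crossing W,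
      (Finsupp.single (M.γ e (b e)) 1 - Finsupp.single (M.γ e (a e)) 1)) := by
  classical
  set h : Γ → ℝ := fun x => if x ∈ W then 0 else t with hh
  refine Exists.imp ?_ (M.exists_isPrincipal hΓ h
    (fun e => if M.γ e 0 ∈ W then (if M.γ e (M.len e) ∈ W then 0 else -a e)
      else (if M.γ e (M.len e) ∈ W then a e else t))
    (fun e => if e ∈ M.crossing W then min (a e) (b e) else 0)
    (fun e => if e ∈ M.crossing W then max (a e) (b e) else 0)
    (fun e => if M.γ e 0 ∈ W then (if M.γ e (M.len e) ∈ W then 0 else 1)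
      else (if M.γ e (M.len e) ∈ W then -1 else 0)) ?_ ?_ ?_ ?_ ?_)
  · intro φ hφ
    convert! hφ using 1
    rw [← Finset.sum_filter_add_sum_filter_not Finset.univ (· ∈ M.crossing W)]
    rw [Finset.filter_univ_mem, Finset.sum_eq_zero (s := Finset.univ.filter _), add_zero]
    · refine Finset.sum_congr rfl fun e he => ?_
      have hc := M.mem_crossing.1 he
      simp only [he, if_true]
      by_cases h0 : M.γ e 0 ∈ W
      · have h1 : M.γ e (M.len e) ∉ W := by tauto
        have := hab e h0 h1
        rw [min_eq_left (by linarith), max_eq_right (by linarith)]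
        simp [h0, h1]
      · have h1 : M.γ e (M.len e) ∈ W := by tauto
        have := hba e h0 h1
        rw [min_eq_right (by linarith), max_eq_left (by linarith)]
        simp [h0, h1]
    · intro e he
      have hc := (Finset.mem_filter.1 he).2
      simp [hc]
  · intro e
    split_ifs with he
    · exact le_min (hmem e he).1.1 (hmem e he).2.1
    · exact le_rfl
  · intro e
    split_ifs with he
    · exact min_le_max
    · exact le_rfl
  · intro e
    split_ifs with he
    · exact max_le (hmem e he).1.2 (hmem e he).2.2
    · exact (M.len_pos e).le
  all_goals
    intro e
    have hc := M.mem_crossing (W := W) (e := e)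
    by_cases h0 : M.γ e 0 ∈ W <;> by_cases h1 : M.γ e (M.len e) ∈ W
    · have : e ∉ M.crossing W := by rw [hc]; tauto
      simp [hh, h0, h1]
    · have hcr : e ∈ M.crossing W := by rw [hc]; tauto
      have := hab e h0 h1
      rw [if_pos hcr]
      simp only [hh, h0, h1, if_true, if_false]
      first
        | rw [min_eq_left (by linarith)]; push_cast; linarith
        | rw [max_eq_right (by linarith)]; push_cast; linarith
    · have hcr : e ∈ M.crossing W := by rw [hc]; tauto
      have := hba e h0 h1
      rw [if_pos hcr]
      simp only [hh, h0, h1, if_true, if_false]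
      first
        | rw [min_eq_right (by linarith)]; push_cast; linarith
        | rw [max_eq_left (by linarith)]; push_cast; linarith
    · have : e ∉ M.crossing W := by rw [hc]; tauto
      simp [hh, h0, h1]

end EdgeModel

namespace EdgeModel

variable {Γ : Type*} [MetricSpace Γ] (M : EdgeModel Γ)

/-! ### Principal divisors have degree zero -/

theorem HasSlope.unique {φ : Γ → ℝ} {p : Γ} {d : M.Direction} {m m' : ℤ}
    (h : M.HasSlope φ p d m) (h' : M.HasSlope φ p d m') : m = m' := by
  obtain ⟨δ, hδ, h⟩ := h
  obtain ⟨δ', hδ', h'⟩ := h'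
  have hmin : 0 < min δ δ' := lt_min hδ hδ'
  have e1 := min_le_left δ δ'
  have e2 := min_le_right δ δ'
  have h1 := h (min δ δ' / 2) ⟨by linarith, by linarith⟩
  rw [h' (min δ δ' / 2) ⟨by linarith, by linarith⟩] at h1
  have h2 : (m' : ℝ) * (min δ δ' / 2) = m * (min δ δ' / 2) := by linarith
  exact_mod_cast (mul_right_cancel₀ (by linarith) h2).symm

theorem _root_.TropicalGraph.IsRational.exists_hasSlope {φ : Γ → ℝ} (h : IsRational φ) {p : Γ}
    {d : M.Direction} (hd : d ∈ M.dirs p) : ∃ m, M.HasSlope φ p d m := by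
  obtain ⟨e, b⟩ := d
  obtain ⟨t, ht, rfl, h1, h2⟩ := M.mem_dirs.1 hd
  obtain ⟨δ, hδ, hr, hl⟩ :=
    (h.piecewise (M.len e) (M.len_pos e) (M.γ e) (M.dist_eq e)).exists_local t
  unfold HasSlope ray
  simp only [M.param_γ ht]
  cases b
  · obtain ⟨m, hm⟩ := hl ⟨h2 rfl, ht.2⟩
    refine ⟨m, δ, hδ, fun s hs => ?_⟩
    rw [← hm s hs]
    simp [sgn, sub_eq_add_neg]
  · obtain ⟨m, hm⟩ := hr ⟨ht.1, h1 rfl⟩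
    refine ⟨m, δ, hδ, fun s hs => ?_⟩
    rw [← hm s hs]
    simp [sgn]

theorem hasSlope_true {φ : Γ → ℝ} {e : Fin M.n} {t u : ℝ} {m : ℤ} (ht : t ∈ Icc 0 (M.len e))
    (htu : t < u) (h : ∀ s ∈ Icc t u, φ (M.γ e s) = φ (M.γ e t) + m * (s - t)) :
    M.HasSlope φ (M.γ e t) (e, true) m := by
  refine ⟨u - t, by linarith, fun s hs => ?_⟩
  rw [ray, M.param_γ ht, h _ ⟨by simp [sgn]; linarith [hs.1], by simp [sgn]; linarith [hs.2]⟩]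
  simp [sgn]

theorem hasSlope_false {φ : Γ → ℝ} {e : Fin M.n} {t u : ℝ} {m : ℤ} (ht : t ∈ Icc 0 (M.len e))
    (hut : u < t) (h : ∀ s ∈ Icc u t, φ (M.γ e s) = φ (M.γ e t) + m * (s - t)) :
    M.HasSlope φ (M.γ e t) (e, false) (-m) := by
  refine ⟨t - u, by linarith, fun s hs => ?_⟩
  rw [ray, M.param_γ ht, h _ ⟨by simp [sgn]; linarith [hs.2], by simp [sgn]; linarith [hs.1]⟩]
  simp [sgn]

/-- A rational function whose divisor is supported on the vertices is affine on every edge. -/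
theorem affine_of_support {φ : Γ → ℝ} {Δ : Γ →₀ ℤ} (hφ : IsRational φ) (hd : IsDivisorOf φ Δ)
    (hV : ∀ p, Δ p ≠ 0 → p ∈ M.V) (e : Fin M.n) :
    ∃ m : ℤ, ∀ s ∈ Icc 0 (M.len e), φ (M.γ e s) = φ (M.γ e 0) + m * (s - 0) := by
  classical
  have hmatch : ∀ t ∈ Ioo 0 (M.len e), ∀ m m', M.HasSlope φ (M.γ e t) (e, true) m →
      M.HasSlope φ (M.γ e t) (e, false) m' → m' = -m := by
    intro t ht m m' h h'
    have h0 : Δ (M.γ e t) = 0 := by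
      by_contra hne
      exact M.notMem e t ht (hV _ hne)
    have := (hd (M.γ e t)).eq_sum_dirs M (m := fun d => if d.2 then m else m') (by
      intro d hdd
      rw [M.dirs_inner ht] at hdd
      simp only [Finset.mem_insert, Finset.mem_singleton] at hdd
      rcases hdd with rfl | rfl
      · simpa using h
      · simpa using h')
    rw [h0, M.dirs_inner ht, Finset.sum_pair (by simp)] at this
    simp at this
    omega
  have hex : ∀ t ∈ Icc 0 (M.len e), ∃ δ > 0, (t ∈ Ico 0 (M.len e) → ∃ m : ℤ, ∀ s ∈ Ico 0 δ,
      φ (M.γ e (t + s)) = φ (M.γ e t) + m * s) ∧ (t ∈ Ioc 0 (M.len e) → ∃ m : ℤ, ∀ s ∈ Ico 0 δ,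
      φ (M.γ e (t - s)) = φ (M.γ e t) + m * s) := fun t _ =>
    (hφ.piecewise (M.len e) (M.len_pos e) (M.γ e) (M.dist_eq e)).exists_local t
  refine interval_induction (M.len_pos e).le (fun x y => ∃ m : ℤ, ∀ s ∈ Icc x y,
    φ (M.γ e s) = φ (M.γ e x) + m * (s - x)) ?_ ?_
  · rintro x y z hx hxy hyz hz ⟨m, hm⟩ ⟨m', hm'⟩
    rcases hxy.eq_or_lt with rfl | hxy'
    · exact ⟨m', hm'⟩
    rcases hyz.eq_or_lt with rfl | hyz'
    · exact ⟨m, hm⟩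
    have hy := hm y ⟨hxy, le_rfl⟩
    have hyI : y ∈ Icc 0 (M.len e) := ⟨by linarith, by linarith⟩
    have h1 := hmatch y ⟨by linarith, by linarith⟩ _ _ (M.hasSlope_true hyI hyz' hm')
      (M.hasSlope_false (m := m) hyI hxy' fun s hs => by rw [hm s hs, hy]; ring)
    have h2 : m = m' := by omega
    subst h2
    refine ⟨m, fun s hs => ?_⟩
    rcases le_total s y with h | h
    · exact hm s ⟨hs.1, h⟩
    · rw [hm' s ⟨h, hs.2⟩, hy]; ring
  · intro t ht
    obtain ⟨δ, hδ, hr, hl⟩ := hex t ht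
    rcases ht.1.eq_or_lt with h0 | h0
    · obtain ⟨m, hm⟩ := hr ⟨ht.1, h0 ▸ M.len_pos e⟩
      refine ⟨δ, hδ, fun x y hx hy h1 hxy h2 => ⟨m, fun s hs => ?_⟩⟩
      have hx' := hm (x - t) ⟨by linarith, by linarith⟩
      have hs' := hm (s - t) ⟨by linarith [hs.1], by linarith [hs.2]⟩
      rw [add_sub_cancel] at hx' hs'
      rw [hx', hs']; ring
    rcases ht.2.eq_or_lt with h1 | h1
    · obtain ⟨m, hm⟩ := hl ⟨h0, ht.2⟩
      refine ⟨δ, hδ, fun x y hx hy h1 hxy h2 => ⟨-m, fun s hs => ?_⟩⟩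
      have hx' := hm (t - x) ⟨by linarith, by linarith⟩
      have hs' := hm (t - s) ⟨by linarith [hs.2], by linarith [hs.1]⟩
      rw [sub_sub_cancel] at hx' hs'
      rw [hx', hs']; push_cast; ring
    · obtain ⟨m, hm⟩ := hr ⟨ht.1, h1⟩
      obtain ⟨m', hm'⟩ := hl ⟨h0, ht.2⟩
      have hmm := hmatch t ⟨h0, h1⟩ _ _
        (M.hasSlope_true (u := t + δ / 2) (m := m) ht (by linarith) fun s hs => by
          have := hm (s - t) ⟨by linarith [hs.1], by linarith [hs.2]⟩
          rwa [add_sub_cancel] at this)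
        (M.hasSlope_false (u := t - δ / 2) (m := -m') ht (by linarith) fun s hs => by
          have := hm' (t - s) ⟨by linarith [hs.2], by linarith [hs.1]⟩
          rw [sub_sub_cancel] at this
          rw [this]; push_cast; ring)
      have hmm' : m' = -m := by omega
      subst hmm'
      have key : ∀ s, t - δ < s → s < t + δ → φ (M.γ e s) = φ (M.γ e t) + m * (s - t) := by
        intro s h1 h2
        rcases le_total t s with h | h
        · have := hm (s - t) ⟨by linarith, by linarith⟩
          rwa [add_sub_cancel] at this
        · have := hm' (t - s) ⟨by linarith, by linarith⟩
          rw [sub_sub_cancel] at this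
          rw [this]; push_cast; ring
      refine ⟨δ, hδ, fun x y hx hy h1 hxy h2 => ⟨m, fun s hs => ?_⟩⟩
      rw [key s (by linarith [hs.1]) (by linarith [hs.2]), key x h1 (by linarith)]
      ring

/-- The divisor of a rational function that is supported on the vertices has degree zero: the two
slopes at the ends of every edge cancel. -/
theorem degree_eq_zero {φ : Γ → ℝ} {Δ : Γ →₀ ℤ} (hφ : IsRational φ) (hd : IsDivisorOf φ Δ)
    (hV : ∀ p, Δ p ≠ 0 → p ∈ M.V) : Finsupp.degree Δ = 0 := by
  classical
  choose! m hm using fun p d => hφ.exists_hasSlope M (p := p) (d := d)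
  have hΔ : ∀ p, Δ p = ∑ d ∈ M.dirs p, -m p d := fun p => (hd p).eq_sum_dirs M (hm p)
  have hcancel : ∀ e, m (M.γ e 0) (e, true) + m (M.γ e (M.len e)) (e, false) = 0 := by
    intro e
    obtain ⟨k, hk⟩ := M.affine_of_support hφ hd hV e
    have h1 := M.hasSlope_true (M.left_mem e) (M.len_pos e) hk
    have h2 := M.hasSlope_false (φ := φ) (u := 0) (m := k) (M.right_mem e) (M.len_pos e) fun s hs => by
      rw [hk s hs, hk _ (M.right_mem e)]; ring
    have e1 := (hm _ _ (M.mem_dirs.2 (M.isDir_true.2 ⟨0, ⟨le_rfl, M.len_pos e⟩, rfl⟩))).unique M h1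
    have e2 := (hm _ _ (M.mem_dirs.2
      (M.isDir_false.2 ⟨M.len e, ⟨M.len_pos e, le_rfl⟩, rfl⟩))).unique M h2
    omega
  have hdeg : Finsupp.degree Δ = ∑ p ∈ M.V, Δ p := by
    rw [Finsupp.degree_apply]
    refine Finset.sum_subset (fun p hp => hV p (Finsupp.mem_support_iff.1 hp)) fun p _ hp => ?_
    simpa using hp
  rw [hdeg]
  simp_rw [hΔ, M.sum_dirs]
  rw [Finset.sum_comm]
  refine Finset.sum_eq_zero fun e _ => ?_
  rw [Finset.sum_add_distrib, Finset.sum_eq_single (M.γ e 0), Finset.sum_eq_single (M.γ e (M.len e)),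
    if_pos (M.isDir_true.2 ⟨0, ⟨le_rfl, M.len_pos e⟩, rfl⟩),
    if_pos (M.isDir_false.2 ⟨M.len e, ⟨M.len_pos e, le_rfl⟩, rfl⟩)]
  · have := hcancel e
    omega
  · intro p hp hne
    refine if_neg fun h => ?_
    obtain ⟨t, ht, rfl⟩ := M.isDir_false.1 h
    rcases M.eq_end_of_mem e (Ioc_subset_Icc_self ht) hp with rfl | rfl
    · exact lt_irrefl _ ht.1
    · exact hne rfl
  · exact fun h => absurd (M.len_mem e) h
  · intro p hp hne
    refine if_neg fun h => ?_
    obtain ⟨t, ht, rfl⟩ := M.isDir_true.1 h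
    rcases M.eq_end_of_mem e (Ico_subset_Icc_self ht) hp with rfl | rfl
    · exact hne rfl
    · exact lt_irrefl _ ht.2
  · exact fun h => absurd (M.zero_mem e) h

end EdgeModel

/-! ### Spanning trees of a finite multigraph -/

section Multigraph

variable {V E : Type*} (src tgt : E → V)

/-- The edge `e` has exactly one end in `S`. -/
def Crosses (e : E) (S : Set V) : Prop := ¬ (src e ∈ S ↔ tgt e ∈ S)

/-- The edges in `T` connect all vertices: no proper nonempty set of vertices is closed under
passing along the edges in `T`. -/
def EdgeConnected (T : Finset E) : Prop :=
  ∀ S : Set V, S.Nonempty → (∀ e ∈ T, (src e ∈ S ↔ tgt e ∈ S)) → S = univ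

/-- A spanning tree, as a connecting set of edges of the right cardinality. -/
structure IsSpanningTree [Fintype V] (T : Finset E) : Prop where
  conn : EdgeConnected src tgt T
  card : T.card + 1 = Fintype.card V

/-- The coboundary of a function on the vertices. -/
def edgeDiff (T : Finset E) : (V → ℝ) →ₗ[ℝ] (T → ℝ) where
  toFun h e := h (tgt e) - h (src e)
  map_add' h h' := by funext e; simp only [Pi.add_apply]; ring
  map_smul' a h := by funext e; simp only [Pi.smul_apply, smul_eq_mul, RingHom.id_apply]; ring

variable {src tgt}

theorem finrank_ker_edgeDiff [Nonempty V] {T : Finset E}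
    (hT : EdgeConnected src tgt T) :
    Module.finrank ℝ (LinearMap.ker (edgeDiff src tgt T)) = 1 := by
  have : LinearMap.ker (edgeDiff src tgt T) = Submodule.span ℝ {fun _ => (1 : ℝ)} := by
    ext h
    rw [LinearMap.mem_ker, Submodule.mem_span_singleton]
    constructor
    · intro hh
      obtain ⟨v₀⟩ := ‹Nonempty V›
      have hS := hT {v | h v = h v₀} ⟨v₀, rfl⟩ fun e he => by
        have := congrFun hh ⟨e, he⟩
        simp only [edgeDiff, LinearMap.coe_mk, AddHom.coe_mk, Pi.zero_apply] at this
        have heq : h (tgt e) = h (src e) := by linarith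
        simp [heq]
      refine ⟨h v₀, ?_⟩
      funext v
      have : v ∈ {v | h v = h v₀} := hS ▸ mem_univ v
      simpa using this.symm
    · rintro ⟨a, rfl⟩
      funext e
      simp [edgeDiff]
  rw [this]
  exact finrank_span_singleton (fun h => one_ne_zero (congrFun h (Classical.arbitrary V)))

theorem Crosses.exists_ends {e : E} {S : Set V} (h : Crosses src tgt e S) :
    ∃ x ∈ S, ∃ y ∉ S, (src e = x ∧ tgt e = y ∨ src e = y ∧ tgt e = x) := by
  unfold Crosses at h
  by_cases hs : src e ∈ S
  · exact ⟨_, hs, _, fun ht => h ⟨fun _ => ht, fun _ => hs⟩, Or.inl ⟨rfl, rfl⟩⟩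
  · have ht : tgt e ∈ S := by
      by_contra ht
      exact h ⟨fun h' => absurd h' hs, fun h' => absurd h' ht⟩
    exact ⟨_, ht, _, hs, Or.inr ⟨rfl, rfl⟩⟩

/-- If `t` is the only edge of the connecting set `T` that leaves `X`, then the other edges in `T`
connect `X`: a set closed under passing along them contains all of `X` or nothing of it. -/
theorem EdgeConnected.mem_iff_of_unique_crossing {T : Finset E} (hT : EdgeConnected src tgt T)
    {t : E} {x y : V} (hends : src t = x ∧ tgt t = y ∨ src t = y ∧ tgt t = x)
    {X Y : Set V} (hy : y ∉ X)
    (hX : ∀ f ∈ T, f ≠ t → (src f ∈ X ↔ tgt f ∈ X)) (hY : ∀ f ∈ T, f ≠ t → (src f ∈ Y ↔ tgt f ∈ Y))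
    {x' : V} (hx' : x' ∈ X) : x ∈ Y ↔ x' ∈ Y := by
  -- a set closed under the edges other than `t`, and avoiding both ends of `t`, is empty
  have hempty : ∀ Z : Set V, (∀ f ∈ T, f ≠ t → (src f ∈ Z ↔ tgt f ∈ Z)) → x ∉ Z → y ∉ Z →
      ∀ z, z ∉ Z := by
    intro Z hZ h1 h2 z hz
    have := hT Z ⟨z, hz⟩ fun f hf => by
      by_cases hft : f = t
      · subst hft
        rcases hends with ⟨hs, ht⟩ | ⟨hs, ht⟩ <;> rw [hs, ht]
        · exact ⟨fun h => absurd h h1, fun h => absurd h h2⟩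
        · exact ⟨fun h => absurd h h2, fun h => absurd h h1⟩
      · exact hZ f hf hft
    exact h1 (this ▸ mem_univ _)
  constructor
  · intro hxY
    by_contra hx'Y
    refine hempty (X \ Y) (fun f hf hfe => ?_) (fun h => h.2 hxY) (fun h => hy h.1) x' ⟨hx', hx'Y⟩
    simp only [mem_sdiff, hX f hf hfe, hY f hf hfe]
  · intro hx'Y
    by_contra hxY
    refine hempty (X ∩ Y) (fun f hf hfe => ?_) (fun h => hxY h.2) (fun h => hy h.1) x' ⟨hx', hx'Y⟩
    simp only [mem_inter_iff, hX f hf hfe, hY f hf hfe]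

variable [Fintype V]

theorem finrank_range_edgeDiff [Nonempty V] {T : Finset E}
    (hT : EdgeConnected src tgt T) :
    Module.finrank ℝ (LinearMap.range (edgeDiff src tgt T)) + 1 = Fintype.card V := by
  have := LinearMap.finrank_range_add_finrank_ker (edgeDiff src tgt T)
  rwa [finrank_ker_edgeDiff hT, Module.finrank_fintype_fun_eq_card] at this

theorem EdgeConnected.card_le [Nonempty V] {T : Finset E} (hT : EdgeConnected src tgt T) :
    Fintype.card V ≤ T.card + 1 := by
  rw [← finrank_range_edgeDiff hT]
  have := Submodule.finrank_le (LinearMap.range (edgeDiff src tgt T))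
  rw [Module.finrank_fintype_fun_eq_card, Fintype.card_coe] at this
  omega

theorem IsSpanningTree.not_conn_erase [Nonempty V] [DecidableEq E] {T : Finset E}
    (hT : IsSpanningTree src tgt T)
    {t : E} (ht : t ∈ T) : ¬ EdgeConnected src tgt (T.erase t) := by
  intro h
  have h1 := h.card_le
  have h2 := hT.card
  have h3 := Finset.card_erase_add_one ht
  omega

/-- Growing a tree in a connected graph, one leaf at a time: a property of subtrees that holds for a
vertex and passes to every extension by a leaf holds for some spanning tree. -/
theorem EdgeConnected.grow [DecidableEq V] [DecidableEq E] {T : Finset E}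
    (hT : EdgeConnected src tgt T) (v₀ : V)
    (P : Finset V → Finset E → Prop) (h0 : P {v₀} ∅)
    (hstep : ∀ U F, P U F → F ⊆ T → (∀ f ∈ F, src f ∈ U ∧ tgt f ∈ U) → ∀ e ∈ T, ∀ u ∈ U, ∀ w ∉ U,
      (src e = u ∧ tgt e = w ∨ src e = w ∧ tgt e = u) → P (insert w U) (insert e F)) :
    ∃ F ⊆ T, P Finset.univ F ∧ F.card + 1 = Fintype.card V := by
  have key : ∀ k, k < Fintype.card V → ∃ U F, U.card = k + 1 ∧ F.card = k ∧ F ⊆ T ∧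
      (∀ f ∈ F, src f ∈ U ∧ tgt f ∈ U) ∧ P U F := by
    intro k
    induction k with
    | zero => exact fun _ => ⟨{v₀}, ∅, by simp, by simp, by simp, by simp, h0⟩
    | succ k ih =>
      intro hk
      obtain ⟨U, F, hU, hF, hFT, hFU, hP⟩ := ih (by omega)
      have hUne : (U : Set V).Nonempty := by
        rw [Finset.coe_nonempty, ← Finset.card_pos]; omega
      have hex : ∃ e ∈ T, ¬ (src e ∈ U ↔ tgt e ∈ U) := by
        by_contra! hall
        have := hT (U : Set V) hUne (by simpa using hall)
        rw [Finset.coe_eq_univ] at this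
        rw [this, Finset.card_univ] at hU
        omega
      obtain ⟨e, he, hcr⟩ := hex
      obtain ⟨u, hu, w, hw, hends⟩ : ∃ u ∈ U, ∃ w ∉ U,
          (src e = u ∧ tgt e = w ∨ src e = w ∧ tgt e = u) := by
        by_cases h : src e ∈ U
        · exact ⟨_, h, tgt e, fun h' => hcr ⟨fun _ => h', fun _ => h⟩, Or.inl ⟨rfl, rfl⟩⟩
        · have h' : tgt e ∈ U := by
            by_contra h'
            exact hcr ⟨fun h'' => absurd h'' h, fun h'' => absurd h'' h'⟩
          exact ⟨_, h', src e, h, Or.inr ⟨rfl, rfl⟩⟩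
      have heF : e ∉ F := fun heF => hcr ⟨fun _ => (hFU e heF).2, fun _ => (hFU e heF).1⟩
      refine ⟨insert w U, insert e F, ?_, ?_, ?_, ?_, hstep U F hP hFT hFU e he u hu w hw hends⟩
      · rw [Finset.card_insert_of_notMem hw, hU]
      · rw [Finset.card_insert_of_notMem heF, hF]
      · exact Finset.insert_subset he hFT
      · intro f hf
        rcases Finset.mem_insert.1 hf with rfl | hf
        · rcases hends with ⟨h1, h2⟩ | ⟨h1, h2⟩ <;> simp [h1, h2, hu]
        · exact ⟨Finset.mem_insert_of_mem (hFU f hf).1, Finset.mem_insert_of_mem (hFU f hf).2⟩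
  have hpos : 0 < Fintype.card V := Fintype.card_pos_iff.2 ⟨v₀⟩
  obtain ⟨U, F, hU, hF, hFT, -, hP⟩ := key (Fintype.card V - 1) (by omega)
  have : U = Finset.univ := by
    rw [← Finset.card_eq_iff_eq_univ]; omega
  subst this
  exact ⟨F, hFT, hP, by omega⟩

theorem EdgeConnected.exists_isSpanningTree [Nonempty V] [DecidableEq V] [DecidableEq E]
    {T : Finset E} (hT : EdgeConnected src tgt T) : ∃ F ⊆ T, IsSpanningTree src tgt F := by
  obtain ⟨F, hFT, hP, hc⟩ := hT.grow (Classical.arbitrary V)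
    (fun U F => ∀ S : Set V, (∀ e ∈ F, (src e ∈ S ↔ tgt e ∈ S)) → (∃ x ∈ U, x ∈ S) → ∀ x ∈ U, x ∈ S)
    (by simp) (by
      intro U F hP _ _ e _ u hu w hw hends S hS hne x hx
      have huw : u ∈ S ↔ w ∈ S := by
        have := hS e (Finset.mem_insert_self _ _)
        rcases hends with ⟨h1, h2⟩ | ⟨h1, h2⟩ <;> rw [h1, h2] at this
        · exact this
        · exact this.symm
      have hF := hP S (fun f hf => hS f (Finset.mem_insert_of_mem hf))
      have hU : ∀ y ∈ U, y ∈ S := by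
        obtain ⟨y, hy, hyS⟩ := hne
        rcases Finset.mem_insert.1 hy with rfl | hy
        · exact hF ⟨u, hu, huw.2 hyS⟩
        · exact hF ⟨y, hy, hyS⟩
      rcases Finset.mem_insert.1 hx with rfl | hx
      · exact huw.1 (hU u hu)
      · exact hU x hx)
  refine ⟨F, hFT, ⟨fun S ⟨x, hx⟩ hS => ?_, hc⟩⟩
  exact eq_univ_of_forall fun y => hP S hS ⟨x, Finset.mem_univ _, hx⟩ y (Finset.mem_univ _)

/-- Exchange: if `t` is the only edge of the tree `T` with exactly one end in `W`, it may be replaced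
by any other edge with this property. -/
theorem IsSpanningTree.exchange [DecidableEq E] {T : Finset E} (hT : IsSpanningTree src tgt T)
    {W : Set V} {t b : E} (ht : t ∈ T) (htW : Crosses src tgt t W)
    (honly : ∀ e ∈ T, Crosses src tgt e W → e = t) (hb : b = t ∨ b ∉ T)
    (hbW : Crosses src tgt b W) : IsSpanningTree src tgt (insert b (T.erase t)) := by
  have hbn : b ∉ T.erase t := by
    rcases hb with rfl | hb
    · simp
    · exact fun h => hb (Finset.mem_of_mem_erase h)
  refine ⟨fun Y hY hcl => hT.conn Y hY fun e he => ?_, ?_⟩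
  · by_cases het : e = t
    · subst het
      have hclY : ∀ f ∈ T, f ≠ e → (src f ∈ Y ↔ tgt f ∈ Y) := fun f hf hfe =>
        hcl f (Finset.mem_insert_of_mem (Finset.mem_erase.2 ⟨hfe, hf⟩))
      have hclW : ∀ f ∈ T, f ≠ e → (src f ∈ W ↔ tgt f ∈ W) := fun f hf hfe => by
        by_contra hc
        exact hfe (honly f hf hc)
      have hclWc : ∀ f ∈ T, f ≠ e → (src f ∈ Wᶜ ↔ tgt f ∈ Wᶜ) := fun f hf hfe => by
        simp only [mem_compl_iff, hclW f hf hfe]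
      have hbY := hcl b (Finset.mem_insert_self _ _)
      obtain ⟨x, hx, y, hy, hends⟩ := htW.exists_ends
      obtain ⟨x', hx', y', hy', hends'⟩ := hbW.exists_ends
      have h1 := hT.conn.mem_iff_of_unique_crossing hends hy hclW hclY hx'
      have h2 := hT.conn.mem_iff_of_unique_crossing hends.symm (X := Wᶜ) (fun h => h hx) hclWc hclY
        hy'
      have h3 : x' ∈ Y ↔ y' ∈ Y := by
        rcases hends' with ⟨e1, e2⟩ | ⟨e1, e2⟩ <;> rw [e1, e2] at hbY
        · exact hbY
        · exact hbY.symm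
      have h4 : x ∈ Y ↔ y ∈ Y := h1.trans (h3.trans h2.symm)
      rcases hends with ⟨e1, e2⟩ | ⟨e1, e2⟩ <;> rw [e1, e2]
      · exact h4
      · exact h4.symm
    · exact hcl e (Finset.mem_insert_of_mem (Finset.mem_erase.2 ⟨het, he⟩))
  · rw [Finset.card_insert_of_notMem hbn, Finset.card_erase_add_one ht, hT.card]

/-- The vertices that are separated from the root `q` by the vertex `w` form, together with `w`, a
set that exactly one edge of the tree leaves, namely the edge from `w` towards `q`. -/
theorem IsSpanningTree.exists_cut [DecidableEq E] {T : Finset E}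
    (hT : IsSpanningTree src tgt T) {q w : V} (hqw : w ≠ q) {W : Set V} (hq : q ∉ W)
    (hW : ∀ e ∈ T, Crosses src tgt e W → src e = w ∨ tgt e = w) :
    ∃ W' : Set V, ∃ t ∈ T, W ⊆ W' ∧ w ∈ W' ∧ q ∉ W' ∧ Crosses src tgt t W' ∧
      (∀ e ∈ T, Crosses src tgt e W' → e = t) ∧ (src t = w ∨ tgt t = w) := by
  set 𝓕 : Set (Set V) := {Y | q ∈ Y ∧ ∀ e ∈ T, src e ≠ w → tgt e ≠ w → (src e ∈ Y ↔ tgt e ∈ Y)}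
    with h𝓕
  have : Nonempty V := ⟨q⟩
  -- `S` is the component of `q` in the complement of `w`
  set S := ⋂₀ 𝓕 with hS
  have hqS : q ∈ S := fun Y hY => hY.1
  have hScl : ∀ e ∈ T, src e ≠ w → tgt e ≠ w → (src e ∈ S ↔ tgt e ∈ S) := fun e he h1 h2 =>
    ⟨fun h Y hY => (hY.2 e he h1 h2).1 (h Y hY), fun h Y hY => (hY.2 e he h1 h2).2 (h Y hY)⟩
  have hwS : w ∉ S := fun h => by
    have : ({w}ᶜ : Set V) ∈ 𝓕 := ⟨fun h' => hqw h'.symm, fun e _ h1 h2 =>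
      ⟨fun _ => h2, fun _ => h1⟩⟩
    exact h _ this rfl
  have hWS : W ⊆ Sᶜ := by
    have : Wᶜ ∈ 𝓕 := ⟨hq, fun e he h1 h2 => by
      by_contra hc
      have : Crosses src tgt e W := fun h => hc (by simp only [mem_compl_iff, h])
      rcases hW e he this with h | h
      · exact h1 h
      · exact h2 h⟩
    exact fun x hx hxS => hxS _ this hx
  have hcr : ∀ e, Crosses src tgt e Sᶜ ↔ ¬ (src e ∈ S ↔ tgt e ∈ S) := fun e => by
    unfold Crosses; simp only [mem_compl_iff]; tauto
  have htouch : ∀ e ∈ T, Crosses src tgt e Sᶜ → src e = w ∨ tgt e = w := fun e he hc => by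
    by_contra! h
    exact (hcr e).1 hc (hScl e he h.1 h.2)
  have hex : ∃ t ∈ T, Crosses src tgt t Sᶜ := by
    by_contra! hall
    have := hT.conn S ⟨q, hqS⟩ fun e he => by
      have := hall e he
      rw [hcr] at this
      tauto
    exact hwS (this ▸ mem_univ w)
  obtain ⟨t, ht, htc⟩ := hex
  refine ⟨Sᶜ, t, ht, hWS, hwS, fun h => h hqS, htc, fun t' ht' htc' => ?_, htouch t ht htc⟩
  by_contra hne
  -- otherwise `T` without `t` would still be connected
  refine hT.not_conn_erase ht fun Y hY hcl => hT.conn Y hY fun e he => ?_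
  by_cases het : e = t
  · subst het
    have hYcl : ∀ f ∈ T, src f ≠ w → tgt f ≠ w → (src f ∈ Y ↔ tgt f ∈ Y) := fun f hf h1 h2 =>
      hcl f (Finset.mem_erase.2 ⟨fun hfe => by
        subst hfe
        rcases htouch f hf htc with h | h
        · exact h1 h
        · exact h2 h, hf⟩)
    have hSY : ∀ x ∈ S, ∀ y ∈ S, (x ∈ Y ↔ y ∈ Y) := by
      by_cases hqY : q ∈ Y
      · have : S ⊆ Y := fun x hx => hx Y ⟨hqY, hYcl⟩
        exact fun x hx y hy => ⟨fun _ => this hy, fun _ => this hx⟩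
      · have : S ⊆ Yᶜ := fun x hx => hx Yᶜ ⟨hqY, fun f hf h1 h2 => by
          simp only [mem_compl_iff, hYcl f hf h1 h2]⟩
        exact fun x hx y hy => ⟨fun h => absurd h (this hx), fun h => absurd h (this hy)⟩
    have ht'Y := hcl t' (Finset.mem_erase.2 ⟨hne, ht'⟩)
    -- the edges `e` and `t'` both join `w` to a vertex of `S`
    have hjoin : ∀ f ∈ T, Crosses src tgt f Sᶜ → ∃ x ∈ S, (src f = x ∧ tgt f = w ∨
        src f = w ∧ tgt f = x) := by
      intro f hf hfc
      obtain ⟨x, hx, y, hy, hends⟩ := hfc.exists_ends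
      rw [mem_compl_iff, not_not] at hy
      rcases hends with ⟨h1, h2⟩ | ⟨h1, h2⟩ <;> rcases htouch f hf hfc with h | h
      · exact ⟨y, hy, Or.inr ⟨h, h2⟩⟩
      · exact absurd ((h2.symm.trans h) ▸ hy) hwS
      · exact absurd ((h1.symm.trans h) ▸ hy) hwS
      · exact ⟨y, hy, Or.inl ⟨h1, h⟩⟩
    obtain ⟨x, hx, hends⟩ := hjoin e he htc
    obtain ⟨x', hx', hends'⟩ := hjoin t' ht' htc'
    have h3 : x' ∈ Y ↔ w ∈ Y := by
      rcases hends' with ⟨e1, e2⟩ | ⟨e1, e2⟩ <;> rw [e1, e2] at ht'Y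
      · exact ht'Y
      · exact ht'Y.symm
    have h4 : x ∈ Y ↔ w ∈ Y := (hSY x hx x' hx').trans h3
    rcases hends with ⟨e1, e2⟩ | ⟨e1, e2⟩ <;> rw [e1, e2]
    · exact h4
    · exact h4.symm
  · exact hcl e (Finset.mem_erase.2 ⟨het, he⟩)

end Multigraph

namespace EdgeModel

variable {Γ : Type*} [MetricSpace Γ] (M : EdgeModel Γ)

/-! ### Chip configurations on the complement of a spanning tree -/

/-- The vertex at the start of an edge. -/
def src (e : Fin M.n) : M.V := ⟨M.γ e 0, M.zero_mem e⟩

/-- The vertex at the end of an edge. -/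
def tgt (e : Fin M.n) : M.V := ⟨M.γ e (M.len e), M.len_mem e⟩

/-- The divisor with one chip on each edge `e` in `A`, at the parameter `pos e`. -/
def chips (A : Finset (Fin M.n)) (pos : Fin M.n → ℝ) : Γ →₀ ℤ :=
  ∑ e ∈ A, Finsupp.single (M.γ e (pos e)) 1

theorem edgeConnected_univ (hΓ : IsMetricGraph Γ) :
    EdgeConnected M.src M.tgt Finset.univ := by
  classical
  intro S ⟨v, hv⟩ hS
  have := hΓ.connected
  -- the function that is `1` on the vertices in `S` and on the edges between them, and `0` elsewhere
  obtain ⟨f, hf, hfV, hfE⟩ := M.exists_glue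
    (fun x => if ∃ h : x ∈ M.V, (⟨x, h⟩ : M.V) ∈ S then (1 : ℝ) else 0)
    (fun e _ => if M.src e ∈ S then (1 : ℝ) else 0) (fun e => continuous_const)
    (fun e => by simp only [src, M.zero_mem e, exists_true_left]; congr)
    (fun e => by
      have := hS e (Finset.mem_univ e)
      simp [this, tgt, M.len_mem e])
  have hval : ∀ x, f x = 0 ∨ f x = 1 := by
    intro x
    rcases M.cover_arc x with h | ⟨e, t, ht, rfl⟩
    · rw [hfV x h]; split_ifs <;> simp
    · rw [hfE e t ht]; split_ifs <;> simp
  have h1 : f v = 1 := by rw [hfV v v.2]; simp [hv]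
  have hcl : IsClopen (f ⁻¹' {1}) := by
    refine ⟨isClosed_singleton.preimage hf, ?_⟩
    have : f ⁻¹' {1} = f ⁻¹' Ioi (1 / 2) := by
      ext x
      rcases hval x with h | h <;> (simp [h]; try norm_num)
    rw [this]
    exact isOpen_Ioi.preimage hf
  have huniv := hcl.eq_univ ⟨v, h1⟩
  refine eq_univ_of_forall fun w => ?_
  have : (w : Γ) ∈ f ⁻¹' {1} := huniv.symm ▸ mem_univ (w : Γ)
  rw [mem_preimage, mem_singleton_iff] at this
  rw [hfV w w.2] at this
  by_contra hw
  simp [hw] at this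

variable {M}

/-- A chip at a vertex of an edge sits at one of the ends of its parameter interval. -/
theorem exists_pos_of_end {e : Fin M.n} {w : M.V} (h : M.src e = w ∨ M.tgt e = w) :
    ∃ t ∈ Icc 0 (M.len e), M.γ e t = w := by
  rcases h with rfl | rfl
  · exact ⟨0, M.left_mem e, rfl⟩
  · exact ⟨M.len e, M.right_mem e, rfl⟩

theorem chips_update_insert {A : Finset (Fin M.n)} {pos : Fin M.n → ℝ} {a b : Fin M.n} {t : ℝ}
    (ha : a ∈ A) (hb : b ∉ A) (h : M.γ b t = M.γ a (pos a)) :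
    M.chips (insert b (A.erase a)) (Function.update pos b t) = M.chips A pos := by
  have hb' : b ∉ A.erase a := fun hm => hb (Finset.mem_of_mem_erase hm)
  unfold chips
  rw [Finset.sum_insert hb', ← Finset.add_sum_erase A _ ha, Function.update_self, h]
  congr 1
  refine Finset.sum_congr rfl fun e he => ?_
  rw [Function.update_of_ne]
  rintro rfl
  exact hb' he

theorem update_mem_Icc {pos : Fin M.n → ℝ} (hpos : ∀ e, pos e ∈ Icc 0 (M.len e)) {b : Fin M.n}
    {t : ℝ} (ht : t ∈ Icc 0 (M.len b)) : ∀ e, Function.update pos b t e ∈ Icc 0 (M.len e) := by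
  intro e
  by_cases h : e = b
  · subst h; rwa [Function.update_self]
  · rw [Function.update_of_ne h]; exact hpos e

/-- If every edge that leaves `W` carries a chip, these chips can be moved away from `W` until one of
them reaches a vertex outside `W`. -/
theorem exists_fire (hΓ : IsMetricGraph Γ) {W : Set M.V} {A : Finset (Fin M.n)}
    {pos : Fin M.n → ℝ} (hpos : ∀ e, pos e ∈ Icc 0 (M.len e))
    (hA : ∀ e, Crosses M.src M.tgt e W → e ∈ A) (hne : ∃ e, Crosses M.src M.tgt e W) :
    ∃ pos' : Fin M.n → ℝ, (∀ e, pos' e ∈ Icc 0 (M.len e)) ∧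
      (∃ φ, IsPrincipal φ (M.chips A pos' - M.chips A pos)) ∧
      ∃ e, Crosses M.src M.tgt e W ∧ ∃ w ∉ W, (M.src e = w ∨ M.tgt e = w) ∧
        M.γ e (pos' e) = w := by
  classical
  -- the distance from the chip on `e` to the end of `e` outside `W`
  set dst : Fin M.n → ℝ := fun e => if M.src e ∈ W then M.len e - pos e else pos e with hdst
  set C : Finset (Fin M.n) := Finset.univ.filter fun e => Crosses M.src M.tgt e W with hC
  have hmemC : ∀ e, e ∈ C ↔ Crosses M.src M.tgt e W := fun e => by simp [hC]
  obtain ⟨e₀, he₀⟩ := hne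
  obtain ⟨e₁, he₁, hmin⟩ := C.exists_min_image dst ⟨e₀, (hmemC e₀).2 he₀⟩
  set t := dst e₁ with ht
  have ht0 : 0 ≤ t := by
    rw [ht, hdst]
    dsimp only
    have := hpos e₁
    split_ifs
    · linarith [this.2]
    · exact this.1
  set pos' : Fin M.n → ℝ := fun e => if e ∈ C then (if M.src e ∈ W then pos e + t else pos e - t)
    else pos e with hpos'
  have hpos'I : ∀ e, pos' e ∈ Icc 0 (M.len e) := by
    intro e
    have hp := hpos e
    by_cases hec : e ∈ C
    · have := hmin e hec
      rw [hdst] at this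
      simp only [hpos', hec, if_true]
      dsimp only at this
      by_cases hs : M.src e ∈ W
      · rw [if_pos hs] at this ⊢
        exact ⟨by linarith [hp.1], by linarith⟩
      · rw [if_neg hs] at this ⊢
        exact ⟨by linarith, by linarith [hp.2]⟩
    · simp only [hpos', hec, if_false]; exact hp
  have himg : ∀ v : M.V, ((v : Γ) ∈ Subtype.val '' W ↔ v ∈ W) := fun v =>
    Subtype.val_injective.mem_set_image
  have hs : ∀ e, (M.γ e 0 ∈ Subtype.val '' W ↔ M.src e ∈ W) := fun e => himg (M.src e)
  have hg : ∀ e, (M.γ e (M.len e) ∈ Subtype.val '' W ↔ M.tgt e ∈ W) := fun e => himg (M.tgt e)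
  have hcross : M.crossing (Subtype.val '' W) = C := by
    ext e
    rw [mem_crossing, hs, hg, hmemC]
    rfl
  refine ⟨pos', hpos'I, ?_, e₁, (hmemC e₁).1 he₁, ?_⟩
  · obtain ⟨φ, hφ⟩ := M.exists_isPrincipal_fire hΓ (Subtype.val '' W) t ht0 pos pos'
      (fun e _ => ⟨hpos e, hpos'I e⟩)
      (fun e h0 h1 => by
        rw [hs] at h0
        rw [hg] at h1
        have : e ∈ C := (hmemC e).2 fun h => h1 (h.1 h0)
        simp [hpos', this, h0])
      (fun e h0 h1 => by
        rw [hs] at h0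
        rw [hg] at h1
        have : e ∈ C := (hmemC e).2 fun h => h0 (h.2 h1)
        simp [hpos', this, h0])
    refine ⟨φ, ?_⟩
    convert! hφ using 1
    rw [hcross]
    have hsub : C ⊆ A := fun e he => hA e ((hmemC e).1 he)
    unfold chips
    rw [← Finset.sum_sub_distrib]
    symm
    refine Finset.sum_subset hsub fun e _ he => ?_
    simp [hpos', he]
  · have hcr := (hmemC e₁).1 he₁
    by_cases h : M.src e₁ ∈ W
    · refine ⟨M.tgt e₁, fun h' => hcr ⟨fun _ => h', fun _ => h⟩, Or.inr rfl, ?_⟩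
      have : pos' e₁ = M.len e₁ := by
        simp only [hpos', he₁, if_true, h, ht, hdst]; ring
      rw [this]; rfl
    · refine ⟨M.src e₁, h, Or.inl rfl, ?_⟩
      have : pos' e₁ = 0 := by
        simp only [hpos', he₁, if_true, h, if_false, ht, hdst]; ring
      rw [this]; rfl

/-- The heart of the argument. Every chip owns an edge, and exactly one chip owns an edge `t` of the
spanning tree `T`; this edge is the only tree edge that leaves the set `W` of vertices, and some
unowned edge `b` outside `T` starts at a vertex `q` outside `W`. Then the divisor is equivalent to one
whose chips own edges outside a spanning tree. If some edge that leaves `W` is unowned, it replaces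
`t` in `T`. Otherwise `W` can be fired until the chip on some edge `e` reaches a vertex `w` outside
`W`; now `e` replaces `t`, and the chip at `w` can pass either to `b`, if `w = q`, or to the tree edge
from `w` towards `q`, which is the only one that leaves a set `W'` with `W ∪ {w} ⊆ W'`. -/
theorem exists_disjoint_tree (hΓ : IsMetricGraph Γ) {b : Fin M.n} (T A : Finset (Fin M.n))
    (W : Set M.V) (t : Fin M.n) (pos : Fin M.n → ℝ) (hT : IsSpanningTree M.src M.tgt T)
    (ht : t ∈ T) (htA : t ∈ A) (hAT : ∀ e ∈ A, e ∈ T → e = t) (htW : Crosses M.src M.tgt t W)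
    (honly : ∀ e ∈ T, Crosses M.src M.tgt e W → e = t) (hq : M.src b ∉ W) (hbA : b ∉ A)
    (hbT : b ∉ T) (hpos : ∀ e, pos e ∈ Icc 0 (M.len e)) :
    ∃ (T' A' : Finset (Fin M.n)) (pos' : Fin M.n → ℝ), IsSpanningTree M.src M.tgt T' ∧
      Disjoint A' T' ∧ A'.card = A.card ∧ (∀ e, pos' e ∈ Icc 0 (M.len e)) ∧
      ∃ φ, IsPrincipal φ (M.chips A' pos' - M.chips A pos) := by
  classical
  induction hk : Wᶜ.ncard using Nat.strong_induction_on generalizing T A W t pos with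
  | _ k ih =>
  by_cases hfree : ∃ e, Crosses M.src M.tgt e W ∧ e ∉ A
  · obtain ⟨e, heW, heA⟩ := hfree
    have heT : e ∉ T := fun h => heA (honly e h heW ▸ htA)
    refine ⟨_, A, pos, hT.exchange ht htW honly (Or.inr heT) heW, ?_, rfl, hpos, fun _ => 0, ?_⟩
    · rw [Finset.disjoint_left]
      intro f hfA hf
      rcases Finset.mem_insert.1 hf with rfl | hf
      · exact heA hfA
      · exact (Finset.mem_erase.1 hf).1 (hAT f hfA (Finset.mem_of_mem_erase hf))
    · rw [sub_self]
      exact IsPrincipal.zero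
  · push Not at hfree
    obtain ⟨pos₁, hpos₁, ⟨φ, hφ⟩, e, heW, w, hwW, hew, hpw⟩ :=
      exists_fire hΓ hpos hfree ⟨t, htW⟩
    have heA := hfree e heW
    have het : e = t ∨ e ∉ T := by
      by_cases h : e ∈ T
      · exact Or.inl (hAT e heA h)
      · exact Or.inr h
    have hT' := hT.exchange ht htW honly het heW
    set T' := insert e (T.erase t) with hTdef
    have hAT' : ∀ f ∈ A, f ∈ T' → f = e := by
      intro f hfA hf
      rcases Finset.mem_insert.1 hf with rfl | hf
      · rfl
      · exact absurd (hAT f hfA (Finset.mem_of_mem_erase hf)) (Finset.mem_erase.1 hf).1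
    have hbe : b ≠ e := fun h => hbA (h ▸ heA)
    have hbT' : b ∉ T' := fun h => by
      rcases Finset.mem_insert.1 h with h | h
      · exact hbe h
      · exact hbT (Finset.mem_of_mem_erase h)
    by_cases hwq : w = M.src b
    · refine ⟨T', insert b (A.erase e), Function.update pos₁ b 0, hT', ?_, ?_,
        update_mem_Icc hpos₁ (M.left_mem b), φ, ?_⟩
      · rw [Finset.disjoint_left]
        intro f hf hfT
        rcases Finset.mem_insert.1 hf with rfl | hf
        · exact hbT' hfT
        · exact (Finset.mem_erase.1 hf).1 (hAT' f (Finset.mem_of_mem_erase hf) hfT)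
      · rw [Finset.card_insert_of_notMem fun h => hbA (Finset.mem_of_mem_erase h),
          Finset.card_erase_add_one heA]
      · rw [chips_update_insert heA hbA]
        · exact hφ
        · rw [hpw, hwq]; rfl
    · obtain ⟨W', t', ht', hWW', hwW', hqW', htW', honly', htw⟩ :=
        hT'.exists_cut hwq hq fun f hf hfW => by
          rcases Finset.mem_insert.1 hf with rfl | hf
          · exact hew
          · exact absurd (honly f (Finset.mem_of_mem_erase hf) hfW) (Finset.mem_erase.1 hf).1
      -- both ends of `e` lie in `W'`
      have heW' : ¬ Crosses M.src M.tgt e W' := by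
        obtain ⟨x, hx, y, hy, hends⟩ := heW.exists_ends
        have hyw : y = w := by
          rcases hends with ⟨h1, h2⟩ | ⟨h1, h2⟩ <;> rcases hew with h | h
          · exact absurd (h ▸ h1.symm ▸ hx) hwW
          · exact h2.symm.trans h
          · exact h1.symm.trans h
          · exact absurd (h ▸ h2.symm ▸ hx) hwW
        have hyW' : y ∈ W' := hyw ▸ hwW'
        unfold Crosses
        rw [not_not]
        rcases hends with ⟨h1, h2⟩ | ⟨h1, h2⟩ <;> rw [h1, h2]
        · exact ⟨fun _ => hyW', fun _ => hWW' hx⟩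
        · exact ⟨fun _ => hWW' hx, fun _ => hyW'⟩
      have hte : t' ≠ e := fun h => heW' (h ▸ htW')
      have htA' : t' ∉ A := fun h => hte (hAT' t' h ht')
      obtain ⟨s, hs, hsw⟩ := exists_pos_of_end htw
      have hlt : W'ᶜ.ncard < k := by
        rw [← hk]
        refine Set.ncard_lt_ncard ?_ (Set.toFinite _)
        refine ⟨compl_subset_compl.2 hWW', fun h => ?_⟩
        exact h hwW hwW'
      obtain ⟨T₂, A₂, pos₂, hT₂, hd₂, hc₂, hp₂, ψ, hψ⟩ := ih _ hlt T' (insert t' (A.erase e)) W' t'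
        (Function.update pos₁ t' s) hT' ht' (Finset.mem_insert_self _ _)
        (fun f hf hfT => by
          rcases Finset.mem_insert.1 hf with h | h
          · exact h
          · exact absurd (hAT' f (Finset.mem_of_mem_erase h) hfT) (Finset.mem_erase.1 h).1)
        htW' honly' hqW'
        (fun h => by
          rcases Finset.mem_insert.1 h with h | h
          · exact hbT' (h ▸ ht')
          · exact hbA (Finset.mem_of_mem_erase h))
        hbT' (update_mem_Icc hpos₁ hs) rfl
      rw [chips_update_insert heA htA' (hsw.trans hpw.symm)] at hψ
      refine ⟨T₂, A₂, pos₂, hT₂, hd₂, ?_, hp₂, ψ + φ, ?_⟩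
      · rw [hc₂, Finset.card_insert_of_notMem fun h => htA' (Finset.mem_of_mem_erase h),
          Finset.card_erase_add_one heA]
      · have := hψ.add hφ
        rwa [sub_add_sub_cancel] at this

/-- A chip at a vertex can be added to a configuration of chips outside a spanning tree, as long as
there is an unowned edge outside the tree. -/
theorem exists_add_chip (hΓ : IsMetricGraph Γ) {T A : Finset (Fin M.n)} {pos : Fin M.n → ℝ}
    (hT : IsSpanningTree M.src M.tgt T) (hAT : Disjoint A T)
    (hpos : ∀ e, pos e ∈ Icc 0 (M.len e)) (hcard : A.card + T.card < M.n) (p : M.V) :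
    ∃ (T' A' : Finset (Fin M.n)) (pos' : Fin M.n → ℝ), IsSpanningTree M.src M.tgt T' ∧
      Disjoint A' T' ∧ A'.card = A.card + 1 ∧ (∀ e, pos' e ∈ Icc 0 (M.len e)) ∧
      ∃ φ, IsPrincipal φ (M.chips A' pos' - (M.chips A pos + Finsupp.single (p : Γ) 1)) := by
  classical
  have hins : ∀ (a : Fin M.n) (s : ℝ), a ∉ A → M.γ a s = p →
      M.chips (insert a A) (Function.update pos a s) = M.chips A pos + Finsupp.single (p : Γ) 1 := by
    intro a s ha hs
    unfold chips
    rw [Finset.sum_insert ha, Function.update_self, hs, add_comm]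
    congr 1
    refine Finset.sum_congr rfl fun e he => ?_
    rw [Function.update_of_ne]
    rintro rfl
    exact ha he
  obtain ⟨b, hb⟩ : ∃ b, b ∉ A ∪ T := by
    by_contra! hall
    have : A ∪ T = Finset.univ := Finset.eq_univ_of_forall hall
    have := Finset.card_union_le A T
    simp_all
    omega
  rw [Finset.mem_union, not_or] at hb
  by_cases hpb : p = M.src b
  · refine ⟨T, insert b A, Function.update pos b 0, hT, ?_, Finset.card_insert_of_notMem hb.1,
      update_mem_Icc hpos (M.left_mem b), fun _ => 0, ?_⟩
    · rw [Finset.disjoint_insert_left]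
      exact ⟨hb.2, hAT⟩
    · rw [hins b 0 hb.1 (by rw [hpb]; rfl), sub_self]
      exact IsPrincipal.zero
  · obtain ⟨W, t, ht, -, hpW, hqW, htW, honly, htp⟩ := hT.exists_cut hpb (W := ∅)
      (notMem_empty _) fun e _ h => absurd Iff.rfl h
    have htA : t ∉ A := fun h => Finset.disjoint_left.1 hAT h ht
    obtain ⟨s, hs, hsp⟩ := exists_pos_of_end htp
    obtain ⟨T', A', pos', hT', hd, hc, hp', φ, hφ⟩ := exists_disjoint_tree hΓ (b := b) T (insert t A)
      W t (Function.update pos t s) hT ht (Finset.mem_insert_self _ _)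
      (fun f hf hfT => by
        rcases Finset.mem_insert.1 hf with h | h
        · exact h
        · exact absurd hfT (Finset.disjoint_left.1 hAT h))
      htW honly hqW
      (fun h => by
        rcases Finset.mem_insert.1 h with h | h
        · exact hb.2 (h ▸ ht)
        · exact hb.1 h)
      hb.2 (update_mem_Icc hpos hs)
    rw [hins t s htA hsp] at hφ
    exact ⟨T', A', pos', hT', hd, by rw [hc, Finset.card_insert_of_notMem htA], hp', φ, hφ⟩

/-- An effective divisor that is supported on the vertices, and whose degree is at most the number of
edges outside a spanning tree, is equivalent to a configuration of chips that own distinct edges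
outside a spanning tree. -/
theorem exists_chips (hΓ : IsMetricGraph Γ) (d : ℕ) (hd : d + M.V.card ≤ M.n + 1) (E : Γ →₀ ℤ)
    (hE : 0 ≤ E) (hV : ∀ p, E p ≠ 0 → p ∈ M.V) (hdeg : Finsupp.degree E = (d : ℤ)) :
    ∃ (T A : Finset (Fin M.n)) (pos : Fin M.n → ℝ), IsSpanningTree M.src M.tgt T ∧
      Disjoint A T ∧ A.card = d ∧ (∀ e, pos e ∈ Icc 0 (M.len e)) ∧
      ∃ φ, IsPrincipal φ (M.chips A pos - E) := by
  classical
  have := hΓ.connected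
  have hne : Nonempty M.V := by
    rcases M.cover_arc (Classical.arbitrary Γ) with h | ⟨e, -⟩
    · exact ⟨⟨_, h⟩⟩
    · exact ⟨M.src e⟩
  induction d generalizing E with
  | zero =>
    obtain ⟨T, -, hT⟩ := (M.edgeConnected_univ hΓ).exists_isSpanningTree
    have hE0 : E = 0 := by
      rw [Finsupp.degree_apply, Nat.cast_zero, Finset.sum_eq_zero_iff_of_nonneg fun p _ => hE p]
        at hdeg
      ext p
      by_contra hp
      exact hp (hdeg p (Finsupp.mem_support_iff.2 hp))
    refine ⟨T, ∅, fun _ => 0, hT, Finset.disjoint_empty_left T, rfl, M.left_mem, fun _ => 0, ?_⟩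
    rw [hE0, chips, Finset.sum_empty, sub_zero]
    exact IsPrincipal.zero
  | succ d ih =>
    obtain ⟨p, hp⟩ : ∃ p, E p ≠ 0 := by
      by_contra! h
      have : E = 0 := by ext p; exact h p
      rw [this, map_zero] at hdeg
      push_cast at hdeg
      omega
    have hp0 : 1 ≤ E p := by
      have : 0 ≤ E p := hE p
      omega
    obtain ⟨T, A, pos, hT, hAT, hA, hpos, φ, hφ⟩ := ih (by omega) (E - Finsupp.single p 1)
      (fun x => by
        rw [Finsupp.sub_apply, Finsupp.single_apply]
        have : 0 ≤ E x := hE x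
        split_ifs with h
        · subst h; simpa using hp0
        · simpa using this)
      (fun x hx => by
        rw [Finsupp.sub_apply, Finsupp.single_apply] at hx
        split_ifs at hx with h
        · subst h; exact hV _ hp
        · exact hV x (by simpa using hx))
      (by rw [map_sub, hdeg, Finsupp.degree_single]; push_cast; ring)
    have hc := hT.card
    rw [Fintype.card_coe] at hc
    obtain ⟨T', A', pos', hT', hAT', hA', hpos', ψ, hψ⟩ :=
      exists_add_chip hΓ hT hAT hpos (by omega) ⟨p, hV p hp⟩
    refine ⟨T', A', pos', hT', hAT', by rw [hA', hA], hpos', ψ + φ, ?_⟩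
    have := hψ.add hφ
    convert! this using 1
    abel

end EdgeModel

/-! ### Cochains on affine simplices -/

theorem coboundary_zero_apply {X : Type*} [TopologicalSpace X] (f : SingularSimplex X 0 → ℝ)
    (σ : SingularSimplex X 1) : coboundary X 0 f σ = f (σ.face 0) - f (σ.face 1) := by
  refine (Fin.sum_univ_two fun i : Fin 2 => (-1 : ℝ) ^ (i : ℕ) * f (σ.face i)).trans ?_
  simp
  ring

theorem coboundary_one_apply {X : Type*} [TopologicalSpace X] (c : SingularSimplex X 1 → ℝ)
    (σ : SingularSimplex X 2) :
    coboundary X 1 c σ = c (σ.face 0) - c (σ.face 1) + c (σ.face 2) := by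
  refine (Fin.sum_univ_three fun i : Fin 3 => (-1 : ℝ) ^ (i : ℕ) * c (σ.face i)).trans ?_
  simp
  ring

section Affine

variable {X : Type*} [TopologicalSpace X] {E : Type*} [AddCommGroup E] [Module ℝ E]
  [TopologicalSpace E] [IsTopologicalAddGroup E] [ContinuousSMul ℝ E]

/-- The singular simplex obtained from a continuous map on a vector space and the affine simplex with
given vertices. -/
def affineSimplex {n : ℕ} (F : C(E, X)) (y : Fin (n + 1) → E) : SingularSimplex X n :=
  F.comp ⟨fun x => ∑ i, x i • y i, continuous_finsetSum _ fun i _ =>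
    ((continuous_apply i).comp continuous_subtype_val).smul continuous_const⟩

theorem affineSimplex_apply {n : ℕ} (F : C(E, X)) (y : Fin (n + 1) → E)
    (x : stdSimplex ℝ (Fin (n + 1))) :
    affineSimplex F y x = F (∑ i, x i • y i) := rfl

theorem affineSimplex_face {n : ℕ} (F : C(E, X)) (y : Fin (n + 2) → E) (i : Fin (n + 2)) :
    (affineSimplex F y).face i = affineSimplex F (y ∘ i.succAbove) := by
  ext x
  rw [affineSimplex_apply]
  change F _ = F _
  congr 1
  change ∑ j, (stdSimplex.map i.succAbove x) j • y j = _
  rw [Fin.sum_univ_succAbove _ i]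
  simp [stdSimplex.map_coe, FunOnFinite.linearMap_apply_apply, Finset.sum_filter]

/-- The value of a cochain on the image of the segment from `a` to `b`. -/
def along (c : SingularSimplex X 1 → ℝ) (F : C(E, X)) (a b : E) : ℝ := c (affineSimplex F ![a, b])

theorem along_add {c : SingularSimplex X 1 → ℝ} (hc : coboundary X 1 c = 0) (F : C(E, X))
    (a b d : E) : along c F a b + along c F b d = along c F a d := by
  have h := congrFun hc (affineSimplex F ![a, b, d])
  rw [coboundary_one_apply, affineSimplex_face, affineSimplex_face, affineSimplex_face] at h
  have e0 : (![a, b, d] : Fin 3 → E) ∘ (0 : Fin 3).succAbove = ![b, d] := by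
    funext i; fin_cases i <;> rfl
  have e1 : (![a, b, d] : Fin 3 → E) ∘ (1 : Fin 3).succAbove = ![a, d] := by
    funext i; fin_cases i <;> rfl
  have e2 : (![a, b, d] : Fin 3 → E) ∘ (2 : Fin 3).succAbove = ![a, b] := by
    funext i; fin_cases i <;> rfl
  rw [e0, e1, e2, Pi.zero_apply] at h
  unfold along
  linarith

theorem along_self {c : SingularSimplex X 1 → ℝ} (hc : coboundary X 1 c = 0) (F : C(E, X))
    (a : E) : along c F a a = 0 := by
  have := along_add hc F a a a
  linarith

theorem along_symm {c : SingularSimplex X 1 → ℝ} (hc : coboundary X 1 c = 0) (F : C(E, X))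
    (a b : E) : along c F b a = -along c F a b := by
  have := along_add hc F a b a
  rw [along_self hc] at this
  linarith

/-- The value on a segment depends only on the map along the segment. -/
theorem along_congr {E' : Type*} [AddCommGroup E'] [Module ℝ E'] [TopologicalSpace E']
    [IsTopologicalAddGroup E'] [ContinuousSMul ℝ E'] (c : SingularSimplex X 1 → ℝ) {F : C(E, X)}
    {G : C(E', X)} {a b : E} {a' b' : E'}
    (h : ∀ t ∈ Icc (0 : ℝ) 1, F ((1 - t) • a + t • b) = G ((1 - t) • a' + t • b')) :
    along c F a b = along c G a' b' := by
  unfold along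
  congr 1
  ext x
  rw [affineSimplex_apply, affineSimplex_apply]
  have hx : x 0 + x 1 = 1 := stdSimplex.add_eq_one x
  have h1 := h (x 1) ⟨stdSimplex.zero_le x 1, stdSimplex.le_one x 1⟩
  rw [← hx, add_sub_cancel_right] at h1
  exact (congrArg F (Fin.sum_univ_two fun i => x i • ![a, b] i)).trans
    (h1.trans (congrArg G (Fin.sum_univ_two fun i => x i • ![a', b'] i)).symm)

theorem coboundary_along (f : SingularSimplex X 0 → ℝ) (F : C(E, X)) (a b : E) :
    along (coboundary X 0 f) F a b =
      f (ContinuousMap.const _ (F b)) - f (ContinuousMap.const _ (F a)) := by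
  have hface : ∀ y : Fin 1 → E, affineSimplex F y = ContinuousMap.const _ (F (y 0)) := by
    intro y
    ext x
    have hx : x 0 = 1 := stdSimplex.eq_one_of_unique (X := Fin 1) x 0
    refine congrArg F ((Fin.sum_univ_one fun i => x i • y i).trans ?_)
    rw [hx, one_smul]
  unfold along
  rw [coboundary_zero_apply, affineSimplex_face, affineSimplex_face, hface, hface]
  have e0 : ((![a, b] : Fin 2 → E) ∘ (0 : Fin 2).succAbove) 0 = b := rfl
  have e1 : ((![a, b] : Fin 2 → E) ∘ (1 : Fin 2).succAbove) 0 = a := rfl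
  rw [e0, e1]

end Affine

/-! ### Paths and winding numbers -/

section Paths

variable {X : Type*} [TopologicalSpace X]

/-- Every singular `1`-simplex is a path on the unit interval. -/
theorem exists_path_eq (σ : SingularSimplex X 1) :
    ∃ p : C(ℝ, X), affineSimplex p ![(0 : ℝ), 1] = σ := by
  let q : C(ℝ, stdSimplex ℝ (Fin 2)) :=
    ⟨fun t => stdSimplexHomeomorphUnitInterval.symm (projIcc 0 1 zero_le_one t),
      stdSimplexHomeomorphUnitInterval.symm.continuous.comp continuous_projIcc⟩
  refine ⟨σ.comp q, ?_⟩
  ext x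
  rw [affineSimplex_apply, ContinuousMap.comp_apply]
  congr 1
  change stdSimplexHomeomorphUnitInterval.symm _ = _
  rw [Homeomorph.symm_apply_eq]
  have h1 : (∑ i, x i • (![(0 : ℝ), 1] : Fin 2 → ℝ) i) = x 1 :=
    (Fin.sum_univ_two _).trans (by simp)
  rw [h1, projIcc_of_mem _ ⟨stdSimplex.zero_le x 1, stdSimplex.le_one x 1⟩]
  apply Subtype.ext
  rfl

theorem mem_range_coboundary_iff {c : SingularSimplex X 1 → ℝ} :
    c ∈ LinearMap.range (coboundary X 0) ↔
      ∃ g : X → ℝ, ∀ (p : C(ℝ, X)) (a b : ℝ), along c p a b = g (p b) - g (p a) := by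
  constructor
  · rintro ⟨f, rfl⟩
    exact ⟨fun x => f (ContinuousMap.const _ x), fun p a b => coboundary_along f p a b⟩
  · rintro ⟨g, hg⟩
    refine ⟨fun σ => g (σ default), ?_⟩
    funext σ
    obtain ⟨p, rfl⟩ := exists_path_eq σ
    have h1 := coboundary_along (fun σ : SingularSimplex X 0 => g (σ default)) p 0 1
    have h2 := hg p 0 1
    unfold along at h1 h2
    rw [h1, h2]
    rfl

theorem coboundary_coboundary_zero (f : SingularSimplex X 0 → ℝ) :
    coboundary X 1 (coboundary X 0 f) = 0 := by
  funext σ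
  have hv : ∀ τ : SingularSimplex X 1, coboundary X 0 f τ =
      f (ContinuousMap.const _ (τ (stdSimplex.vertex 1))) -
        f (ContinuousMap.const _ (τ (stdSimplex.vertex 0))) := by
    intro τ
    obtain ⟨p, rfl⟩ := exists_path_eq τ
    refine (coboundary_along f p 0 1).trans ?_
    rw [affineSimplex_apply, affineSimplex_apply]
    simp [Fin.sum_univ_two, stdSimplex.vertex_coe]
  have hf : ∀ (i : Fin 3) (j : Fin 2), (σ.face i) (stdSimplex.vertex j) =
      σ (stdSimplex.vertex (i.succAbove j)) := by
    intro i j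
    exact congrArg σ (stdSimplex.map_vertex _ _)
  rw [coboundary_one_apply, hv, hv, hv, hf, hf, hf, hf, hf, hf]
  have e : ((0 : Fin 3).succAbove (1 : Fin 2) = 2 ∧ (0 : Fin 3).succAbove (0 : Fin 2) = 1) ∧
    ((1 : Fin 3).succAbove (1 : Fin 2) = 2 ∧ (1 : Fin 3).succAbove (0 : Fin 2) = 0) ∧
    ((2 : Fin 3).succAbove (1 : Fin 2) = 1 ∧ (2 : Fin 3).succAbove (0 : Fin 2) = 0) := by decide
  rw [e.1.1, e.1.2, e.2.1.1, e.2.1.2, e.2.2.1, e.2.2.2]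
  simp

/-- The winding cocycle of a map to the circle: its value on a path is the increment of a lift of the
map along the path. It exists because simplices are simply connected. -/
theorem exists_winding (θ : C(X, AddCircle (1 : ℝ))) :
    ∃ c : SingularSimplex X 1 → ℝ, coboundary X 1 c = 0 ∧
      ∀ (p : C(ℝ, X)) (L : C(ℝ, ℝ)), (∀ t, (L t : AddCircle (1 : ℝ)) = θ (p t)) →
        ∀ a b, along c p a b = L b - L a := by
  have hlift : ∀ {n : ℕ} (σ : SingularSimplex X n),
      ∃ L : C(stdSimplex ℝ (Fin (n + 1)), ℝ), ∀ x, (L x : AddCircle (1 : ℝ)) = θ (σ x) := by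
    intro n σ
    have := (convex_stdSimplex ℝ (Fin (n + 1))).locallyPathConnectedSpace
    have : ContractibleSpace (stdSimplex ℝ (Fin (n + 1))) :=
      (convex_stdSimplex ℝ (Fin (n + 1))).contractibleSpace ⟨_, single_mem_stdSimplex ℝ 0⟩
    have x₀ : stdSimplex ℝ (Fin (n + 1)) := stdSimplex.vertex 0
    obtain ⟨e₀, he₀⟩ := QuotientAddGroup.mk_surjective ((θ.comp σ) x₀)
    obtain ⟨L, ⟨-, hL⟩, -⟩ := (AddCircle.isCoveringMap_coe (1 : ℝ)).existsUnique_continuousMap_lifts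
      (θ.comp σ) x₀ e₀ he₀
    exact ⟨L, fun x => congrFun hL x⟩
  -- two lifts differ by a continuous function with integer values, which is constant
  have huniq : ∀ (L L' : C(stdSimplex ℝ (Fin 2), ℝ)),
      (∀ x, (L x : AddCircle (1 : ℝ)) = L' x) → ∀ x y, L x - L y = L' x - L' y := by
    intro L L' h x y
    have hint : ∀ x, ∃ m : ℤ, (m : ℝ) = L x - L' x := by
      intro x
      have := (QuotientAddGroup.eq_iff_sub_mem).1 (h x)
      obtain ⟨m, hm⟩ := AddSubgroup.mem_zmultiples_iff.1 this
      exact ⟨m, by simpa using hm⟩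
    choose m hm using hint
    have hmc : Continuous m := by
      rw [Int.isClosedEmbedding_coe_real.isEmbedding.continuous_iff]
      have : ((↑) : ℤ → ℝ) ∘ m = fun x => L x - L' x := funext hm
      rw [this]
      fun_prop
    have hpc : PreconnectedSpace (stdSimplex ℝ (Fin 2)) := inferInstance
    have := hpc.constant hmc (x := x) (y := y)
    have h1 := hm x
    have h2 := hm y
    rw [this] at h1
    linarith
  choose L hL using fun σ : SingularSimplex X 1 => hlift σ
  let c : SingularSimplex X 1 → ℝ := fun σ => L σ (stdSimplex.vertex 1) - L σ (stdSimplex.vertex 0)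
  have hc : ∀ (σ : SingularSimplex X 1) (L' : C(stdSimplex ℝ (Fin 2), ℝ)),
      (∀ x, (L' x : AddCircle (1 : ℝ)) = θ (σ x)) →
      c σ = L' (stdSimplex.vertex 1) - L' (stdSimplex.vertex 0) := by
    intro σ L' h
    exact huniq _ _ (fun x => (hL σ x).trans (h x).symm) _ _
  refine ⟨c, ?_, ?_⟩
  · funext σ
    obtain ⟨M, hM⟩ := hlift σ
    have hface : ∀ i : Fin 3, c (σ.face i) =
        M (stdSimplex.vertex (i.succAbove 1)) - M (stdSimplex.vertex (i.succAbove 0)) := by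
      intro i
      have := hc (σ.face i) (M.comp ⟨stdSimplex.map i.succAbove, stdSimplex.continuous_map _⟩)
        (fun x => hM _)
      rw [this]
      simp only [ContinuousMap.comp_apply, ContinuousMap.coe_mk, stdSimplex.map_vertex]
    rw [coboundary_one_apply, hface, hface, hface]
    have e : ((0 : Fin 3).succAbove (1 : Fin 2) = 2 ∧ (0 : Fin 3).succAbove (0 : Fin 2) = 1) ∧
      ((1 : Fin 3).succAbove (1 : Fin 2) = 2 ∧ (1 : Fin 3).succAbove (0 : Fin 2) = 0) ∧
      ((2 : Fin 3).succAbove (1 : Fin 2) = 1 ∧ (2 : Fin 3).succAbove (0 : Fin 2) = 0) := by decide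
    rw [e.1.1, e.1.2, e.2.1.1, e.2.1.2, e.2.2.1, e.2.2.2]
    simp
  · intro p L' hL' a b
    have := hc (affineSimplex p ![a, b]) (affineSimplex L' ![a, b]) (fun x => hL' _)
    unfold along
    rw [this, affineSimplex_apply, affineSimplex_apply]
    simp [Fin.sum_univ_two, stdSimplex.vertex_coe]

end Paths

/-! ### The genus of an edge model -/

/-- Small balls are star-shaped: `m y s` is the point that divides the geodesic from `x` to `y` in the
ratio `s`. -/
theorem IsStarAt.exists_contraction {Γ : Type*} [MetricSpace Γ] {x : Γ} {n : ℕ} {r : ℝ}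
    {leg : Fin n → ℝ → Γ} (h : IsStarAt x n r leg) {δ : ℝ} (hδ : 0 < δ) :
    ∃ ρ > 0, ∃ m : Γ → ℝ → Γ, (∀ y, dist y x < ρ → m y 0 = x ∧ m y 1 = y) ∧
      ContinuousOn (fun z : Γ × ℝ => m z.1 z.2) (Metric.ball x ρ ×ˢ Icc 0 1) ∧
      ∀ y, dist y x < ρ → (∀ s, m y s = x) ∨
        ∃ i, ∃ ℓ ∈ Ico 0 δ, ∀ s, m y s = leg i (s * ℓ) := by
  classical
  obtain ⟨ρ₀, hρ₀, hρr, hb⟩ := h.exists_ball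
  set ρ := min ρ₀ δ with hρdef
  have hρ : 0 < ρ := lt_min hρ₀ hδ
  have hρ1 : ρ ≤ ρ₀ := min_le_left _ _
  have hρ2 : ρ ≤ δ := min_le_right _ _
  let m : Γ → ℝ → Γ := fun y s =>
    if hy : ∃ i, y = leg i (dist y x) then leg hy.choose (s * dist y x) else x
  have hm : ∀ y, dist y x < ρ → y = x ∧ (∀ s, m y s = x) ∨
      ∃ i, y = leg i (dist y x) ∧ ∀ s, m y s = leg i (s * dist y x) := by
    intro y hy
    by_cases hi : ∃ i, y = leg i (dist y x)
    · exact Or.inr ⟨hi.choose, hi.choose_spec, fun s => by simp only [m, dif_pos hi]⟩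
    · refine Or.inl ⟨?_, fun s => by simp only [m, dif_neg hi]⟩
      by_contra hne
      exact hi (hb y (by linarith) hne)
  have hx : ∀ s, m x s = x := by
    intro s
    rcases hm x (by rwa [dist_self]) with h' | ⟨i, -, h'⟩
    · exact h'.2 s
    · rw [h', dist_self, mul_zero, h.center]
  refine ⟨ρ, hρ, m, fun y hy => ?_, ?_, fun y hy => ?_⟩
  · rcases hm y hy with ⟨rfl, h'⟩ | ⟨i, hi, h'⟩
    · exact ⟨h' 0, h' 1⟩
    · exact ⟨by rw [h', zero_mul, h.center], by rw [h', one_mul]; exact hi.symm⟩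
  · -- `m` is Lipschitz in both variables
    have hmem : ∀ y, dist y x < ρ → ∀ s ∈ Icc (0 : ℝ) 1, s * dist y x ∈ Ico 0 r := fun y hy s hs =>
      ⟨mul_nonneg hs.1 dist_nonneg, by nlinarith [hs.1, hs.2, dist_nonneg (x := y) (y := x)]⟩
    have hmd : ∀ y, dist y x < ρ → ∀ s ∈ Icc (0 : ℝ) 1, dist (m y s) x = s * dist y x := by
      intro y hy s hs
      rcases hm y hy with ⟨rfl, h'⟩ | ⟨i, hi, h'⟩
      · rw [h', dist_self, mul_zero]
      · rw [h', h.dist_center i (hmem y hy s hs)]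
    have hlip : ∀ y, dist y x < ρ → ∀ y', dist y' x < ρ → ∀ s ∈ Icc (0 : ℝ) 1,
        ∀ s' ∈ Icc (0 : ℝ) 1, dist (m y s) (m y' s') ≤ dist y y' + ρ * |s - s'| := by
      intro y hy y' hy' s hs s' hs'
      -- first move `s'` to `s`, then `y'` to `y`
      have h1 : dist (m y' s) (m y' s') ≤ ρ * |s - s'| := by
        rcases hm y' hy' with ⟨rfl, h'⟩ | ⟨i, hi, h'⟩
        · rw [h', h', dist_self]; positivity
        · rw [h', h', h.dist_same i _ (hmem y' hy' s hs) _ (hmem y' hy' s' hs'), ← sub_mul, abs_mul,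
            abs_of_nonneg (dist_nonneg (x := y') (y := x)), mul_comm]
          exact mul_le_mul_of_nonneg_right hy'.le (abs_nonneg _)
      have h2 : dist (m y s) (m y' s) ≤ dist y y' := by
        rcases hm y hy with ⟨rfl, h'⟩ | ⟨i, hi, hmi⟩
        · rw [h', dist_comm, hmd y' hy' s hs, dist_comm y y']
          nlinarith [hs.2, dist_nonneg (x := y') (y := y)]
        · rcases hm y' hy' with ⟨rfl, h'⟩ | ⟨j, hj, hmj⟩
          · rw [h', hmd y hy s hs]
            nlinarith [hs.2, dist_nonneg (x := y) (y := y')]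
          · have hy0 : dist y x ∈ Ico 0 r := ⟨dist_nonneg, by linarith⟩
            have hy0' : dist y' x ∈ Ico 0 r := ⟨dist_nonneg, by linarith⟩
            rw [hmi, hmj]
            by_cases hij : i = j
            · subst hij
              have e := h.dist_same i _ hy0 _ hy0'
              rw [← hi, ← hj] at e
              rw [h.dist_same i _ (hmem y hy s hs) _ (hmem y' hy' s hs), ← mul_sub, abs_mul,
                abs_of_nonneg hs.1, e]
              nlinarith [hs.2, abs_nonneg (dist y x - dist y' x)]
            · have e := h.dist_ne i j hij _ hy0 _ hy0'
              rw [← hi, ← hj] at e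
              rw [h.dist_ne i j hij _ (hmem y hy s hs) _ (hmem y' hy' s hs), e]
              nlinarith [hs.2, hy0.1, hy0'.1]
      linarith [dist_triangle (m y s) (m y' s) (m y' s')]
    have : LipschitzOnWith (1 + ρ.toNNReal) (fun z : Γ × ℝ => m z.1 z.2)
        (Metric.ball x ρ ×ˢ Icc 0 1) := by
      refine LipschitzOnWith.of_dist_le_mul fun z hz z' hz' => ?_
      refine (hlip z.1 hz.1 z'.1 hz'.1 z.2 hz.2 z'.2 hz'.2).trans ?_
      rw [NNReal.coe_add, NNReal.coe_one, Real.coe_toNNReal _ hρ.le, add_mul, one_mul]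
      refine add_le_add (le_max_left _ _) (mul_le_mul_of_nonneg_left ?_ hρ.le)
      rw [← Real.dist_eq]
      exact le_max_right _ _
    exact this.continuousOn
  · rcases hm y hy with ⟨-, h'⟩ | ⟨i, -, h'⟩
    · exact Or.inl h'
    · exact Or.inr ⟨i, dist y x, ⟨dist_nonneg, hy.trans_le hρ2⟩, h'⟩

namespace EdgeModel

variable {Γ : Type*} [MetricSpace Γ] (M : EdgeModel Γ)

/-- The parametrization of an edge, extended to the real line by constants. -/
def edgePath (e : Fin M.n) : C(ℝ, Γ) :=
  ⟨fun t => M.γ e (projIcc 0 (M.len e) (M.len_pos e).le t),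
    (M.continuousOn_γ e).comp_continuous (continuous_subtype_val.comp continuous_projIcc)
      fun t => (projIcc 0 (M.len e) (M.len_pos e).le t).2⟩

theorem edgePath_apply {e : Fin M.n} {t : ℝ} (ht : t ∈ Icc 0 (M.len e)) :
    M.edgePath e t = M.γ e t := by
  change M.γ e (projIcc 0 (M.len e) (M.len_pos e).le t) = _
  rw [projIcc_of_mem _ ht]

variable {M}

/-- A cocycle that vanishes on all edge segments vanishes on all paths: a path inside a star can be
contracted along the legs to the centre. -/
theorem along_eq_zero (hΓ : IsMetricGraph Γ) {c : SingularSimplex Γ 1 → ℝ}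
    (hc : coboundary Γ 1 c = 0)
    (hE : ∀ e, ∀ s ∈ Icc 0 (M.len e), ∀ t ∈ Icc 0 (M.len e), along c (M.edgePath e) s t = 0)
    (p : C(ℝ, Γ)) {a b : ℝ} (hab : a ≤ b) : along c p a b = 0 := by
  refine interval_induction hab (fun s t => along c p s t = 0) ?_ ?_
  · intro x y z _ _ _ _ h1 h2
    rw [← along_add hc p x y z, h1, h2, add_zero]
  · intro t _
    obtain ⟨n, r, leg, hs⟩ := hΓ.star (p t)
    obtain ⟨k, δ, hδ, hk⟩ := M.exists_equiv_legs hs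
    obtain ⟨ρ, hρ, m, hm, hmc, hml⟩ := hs.exists_contraction hδ
    obtain ⟨η, hη, hpη⟩ := Metric.continuous_iff.1 p.continuous t ρ hρ
    refine ⟨η, hη, fun u v _ _ hu huv hv => ?_⟩
    have hball : ∀ w ∈ Icc u v, dist (p w) (p t) < ρ := fun w hw => hpη w (by
      rw [Real.dist_eq, abs_lt]
      constructor <;> linarith [hw.1, hw.2])
    -- the contraction of the path, extended continuously to the plane
    let H : C(ℝ × ℝ, Γ) := ⟨fun z => m (p (projIcc u v huv z.1)) (projIcc 0 1 zero_le_one z.2), by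
      refine hmc.comp_continuous (f := fun z : ℝ × ℝ =>
        (p (projIcc u v huv z.1), ((projIcc (0 : ℝ) 1 zero_le_one z.2 : Icc (0 : ℝ) 1) : ℝ))) ?_ ?_
      · have h1 : Continuous fun z : ℝ × ℝ => ((projIcc u v huv z.1 : Icc u v) : ℝ) :=
          continuous_subtype_val.comp (continuous_projIcc.comp continuous_fst)
        have h2 : Continuous fun z : ℝ × ℝ =>
            ((projIcc (0 : ℝ) 1 zero_le_one z.2 : Icc (0 : ℝ) 1) : ℝ) :=
          continuous_subtype_val.comp (continuous_projIcc.comp continuous_snd)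
        exact (p.continuous.comp h1).prodMk h2
      · exact fun z => ⟨hball _ (projIcc u v huv z.1).2, (projIcc 0 1 zero_le_one z.2).2⟩⟩
    have hH : ∀ w ∈ Icc u v, ∀ s ∈ Icc (0 : ℝ) 1, H (w, s) = m (p w) s := by
      intro w hw s hs
      change m (p (projIcc u v huv w)) (projIcc 0 1 zero_le_one s) = _
      rw [projIcc_of_mem _ hw, projIcc_of_mem _ hs]
    have hcst : ∀ s s' : ℝ, along c (ContinuousMap.const ℝ (p t)) s s' = 0 := by
      intro s s'
      exact (along_congr c (a' := s) (b' := s) fun _ _ => rfl).trans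
        (along_self hc (ContinuousMap.const ℝ (p t)) s)
    have hside : ∀ w ∈ Icc u v, along c H (w, 0) (w, 1) = 0 := by
      intro w hw
      have hpt : ∀ s ∈ Icc (0 : ℝ) 1, H ((1 - s) • (w, (0 : ℝ)) + s • (w, (1 : ℝ))) = m (p w) s := by
        intro s hs
        rw [← hH w hw s hs]
        congr 1
        ext <;> simp <;> ring
      rcases hml (p w) (hball w hw) with h' | ⟨i, ℓ, hℓ, h'⟩
      · rw [along_congr c (G := ContinuousMap.const ℝ (p t)) (a' := (0 : ℝ)) (b' := 0)]
        · exact hcst 0 0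
        · intro s hs
          rw [hpt s hs, h']; rfl
      · obtain ⟨d, rfl⟩ := k.surjective i
        have hd := M.mem_dirs.1 d.2
        have hroom := (hk d ℓ hℓ).2
        have h0 := hd.mem_Icc M (s := 0) le_rfl (hd.room_pos M).le
        have h1 := hd.mem_Icc M hℓ.1 hroom.le
        rw [mul_zero, add_zero] at h0
        rw [along_congr c (G := M.edgePath d.1.1) (a' := M.param d.1.1 (p t))
          (b' := M.param d.1.1 (p t) + sgn d.1.2 * ℓ)]
        · exact hE _ _ h0 _ h1
        · intro s hs
          have hsℓ : s * ℓ ∈ Ico 0 δ := ⟨mul_nonneg hs.1 hℓ.1, by nlinarith [hs.2, hℓ.1, hℓ.2]⟩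
          have hsm := hd.mem_Icc M hsℓ.1 (hk d _ hsℓ).2.le
          rw [hpt s hs, h', (hk d _ hsℓ).1]
          have e : (1 - s) • M.param d.1.1 (p t) + s • (M.param d.1.1 (p t) + sgn d.1.2 * ℓ) =
              M.param d.1.1 (p t) + sgn d.1.2 * (s * ℓ) := by
            simp only [smul_eq_mul]; ring
          rw [e, M.edgePath_apply hsm]
          rfl
    have huI : u ∈ Icc u v := ⟨le_rfl, huv⟩
    have hvI : v ∈ Icc u v := ⟨huv, le_rfl⟩
    have hcomb : ∀ s ∈ Icc (0 : ℝ) 1, (1 - s) * u + s * v ∈ Icc u v := fun s hs =>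
      ⟨by nlinarith [hs.1], by nlinarith [hs.2]⟩
    have hbot : along c H (u, 0) (v, 0) = 0 := by
      rw [along_congr c (G := ContinuousMap.const ℝ (p t)) (a' := (0 : ℝ)) (b' := 0)]
      · exact hcst 0 0
      · intro s hs
        have e : (1 - s) • (u, (0 : ℝ)) + s • (v, (0 : ℝ)) = ((1 - s) * u + s * v, 0) := by
          ext <;> simp
        rw [e, hH _ (hcomb s hs) 0 ⟨le_rfl, zero_le_one⟩, (hm _ (hball _ (hcomb s hs))).1]
        rfl
    have htop : along c p u v = along c H (u, 1) (v, 1) := by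
      refine along_congr c fun s hs => ?_
      have e : (1 - s) • (u, (1 : ℝ)) + s • (v, (1 : ℝ)) = ((1 - s) * u + s * v, 1) := by
        ext <;> simp
      rw [e, hH _ (hcomb s hs) 1 ⟨zero_le_one, le_rfl⟩, (hm _ (hball _ (hcomb s hs))).2]
      rfl
    have e1 := along_add hc H (u, 1) (u, 0) (v, 0)
    have e2 := along_add hc H (u, 1) (v, 0) (v, 1)
    rw [along_symm hc H (u, 0) (u, 1), hside u huI, hbot] at e1
    rw [hside v hvI] at e2
    rw [htop]
    linarith

/-- The values of a cocycle on the edges. -/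
def edgeValues (M : EdgeModel Γ) :
    ↥(LinearMap.ker (coboundary Γ 1)) →ₗ[ℝ] ({e // e ∈ (Finset.univ : Finset (Fin M.n))} → ℝ) where
  toFun c e := along c.1 (M.edgePath e) 0 (M.len e)
  map_add' _ _ := rfl
  map_smul' _ _ := rfl

/-- Every assignment of values to the edges comes from a cocycle: the cocycle dual to the edge `e` is
the winding cocycle of the map that wraps `e` once around a circle and collapses everything else. -/
theorem edgeValues_surjective (M : EdgeModel Γ) : Function.Surjective M.edgeValues := by
  classical
  have hdual : ∀ e : Fin M.n, ∃ c : ↥(LinearMap.ker (coboundary Γ 1)),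
      M.edgeValues c = fun e' => if e'.1 = e then 1 else 0 := by
    intro e
    have hl := M.len_pos e
    obtain ⟨θ, hθ, -, hθE⟩ := M.exists_glue (Y := AddCircle (1 : ℝ)) (fun _ => 0)
      (fun e' t => if e' = e then ((t / M.len e : ℝ) : AddCircle (1 : ℝ)) else 0)
      (fun e' => by
        split_ifs
        · exact (AddCircle.continuous_mk' 1).comp (continuous_id.div_const _)
        · exact continuous_const)
      (fun e' => by simp)
      (fun e' => by
        split_ifs with h
        · subst h
          rw [div_self hl.ne']
          exact AddCircle.coe_period 1
        · rfl)
    obtain ⟨c, hc, hcw⟩ := exists_winding (⟨θ, hθ⟩ : C(Γ, AddCircle (1 : ℝ)))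
    refine ⟨⟨c, hc⟩, ?_⟩
    funext e'
    change along c (M.edgePath e') 0 (M.len e') = _
    have hcl : Continuous fun t => ((projIcc 0 (M.len e'.1) (M.len_pos e').le t : Icc _ _) : ℝ) :=
      continuous_subtype_val.comp continuous_projIcc
    have hpath : ∀ t, M.edgePath e' t = M.γ e' (projIcc 0 (M.len e'.1) (M.len_pos e').le t) :=
      fun t => rfl
    by_cases he : e'.1 = e
    · subst he
      rw [hcw (M.edgePath e') ⟨_, hcl.div_const (M.len e')⟩ (fun t => ?_)]
      · simp [hl.ne']
      · change _ = θ (M.edgePath e' t)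
        rw [hpath, hθE _ _ (projIcc 0 (M.len e'.1) (M.len_pos e').le t).2, if_pos rfl]
        rfl
    · rw [hcw (M.edgePath e') (ContinuousMap.const ℝ 0) (fun t => ?_)]
      · simp [he]
      · change _ = θ (M.edgePath e' t)
        rw [hpath, hθE _ _ (projIcc 0 (M.len e'.1) (M.len_pos e').le t).2, if_neg he]
        simp
  choose c hc using hdual
  intro f
  refine ⟨∑ e, f e • c e.1, ?_⟩
  rw [map_sum]
  simp only [map_smul, hc]
  funext e'
  rw [Finset.sum_apply]
  simp only [Pi.smul_apply, smul_eq_mul, mul_ite, mul_one, mul_zero]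
  rw [Finset.sum_eq_single e']
  · simp
  · intro e _ hne
    rw [if_neg fun h => hne (Subtype.ext h.symm)]
  · exact fun h => absurd (Finset.mem_univ _) h

/-- A cocycle is a coboundary if and only if its values on the edges are the differences of a function
on the vertices. -/
theorem comap_edgeValues (hΓ : IsMetricGraph Γ) (M : EdgeModel Γ) :
    (LinearMap.range (edgeDiff M.src M.tgt Finset.univ)).comap M.edgeValues =
      (LinearMap.range (coboundary Γ 0)).comap (LinearMap.ker (coboundary Γ 1)).subtype := by
  classical
  ext ⟨c, hc⟩
  rw [Submodule.mem_comap, Submodule.mem_comap, Submodule.subtype_apply,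
    mem_range_coboundary_iff, LinearMap.mem_range]
  rw [LinearMap.mem_ker] at hc
  constructor
  · rintro ⟨h, hh⟩
    have hh' : ∀ e, along c (M.edgePath e) 0 (M.len e) = h (M.tgt e) - h (M.src e) := fun e =>
      (congrFun hh ⟨e, Finset.mem_univ e⟩).symm
    -- a primitive of the cocycle; it need not be continuous, so it is glued in the indiscrete
    -- topology on `ℝ`
    obtain ⟨g, -, hgV, hgE⟩ := @exists_glue Γ _ M ℝ ⊤
      (fun x => if hx : x ∈ M.V then h ⟨x, hx⟩ else 0)
      (fun e t => h (M.src e) + along c (M.edgePath e) 0 t)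
      (fun e => continuous_top)
      (fun e => by rw [along_self hc, dif_pos (M.zero_mem e), add_zero]; rfl)
      (fun e => by rw [hh' e, dif_pos (M.len_mem e), add_sub_cancel]; rfl)
    refine ⟨g, ?_⟩
    set c' : SingularSimplex Γ 1 → ℝ := c - coboundary Γ 0 (fun σ => g (σ default)) with hc'
    have halong : ∀ (p : C(ℝ, Γ)) (a b : ℝ),
        along c' p a b = along c p a b - (g (p b) - g (p a)) := fun p a b =>
      congrArg (along c p a b - ·) (coboundary_along (fun σ => g (σ default)) p a b)
    have hcc' : coboundary Γ 1 c' = 0 := by rw [hc', map_sub, hc, coboundary_coboundary_zero, sub_zero]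
    have hzero : ∀ e, ∀ s ∈ Icc 0 (M.len e), ∀ t ∈ Icc 0 (M.len e),
        along c' (M.edgePath e) s t = 0 := by
      intro e s hs t ht
      rw [halong, M.edgePath_apply hs, M.edgePath_apply ht, hgE e s hs, hgE e t ht,
        ← along_add hc _ 0 s t]
      ring
    have hle : ∀ (p : C(ℝ, Γ)) (a b : ℝ), a ≤ b → along c p a b = g (p b) - g (p a) := by
      intro p a b hab
      have := along_eq_zero hΓ hcc' hzero p hab
      rw [halong] at this
      linarith
    intro p a b
    rcases le_total a b with hab | hab
    · exact hle p a b hab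
    · rw [along_symm hc, hle p b a hab]; ring
  · rintro ⟨g, hg⟩
    refine ⟨fun v => g v, ?_⟩
    funext e
    change g (M.γ e (M.len e)) - g (M.γ e 0) = along c (M.edgePath e) 0 (M.len e)
    rw [hg, M.edgePath_apply (M.left_mem e.1), M.edgePath_apply (M.right_mem e.1)]

/-- The genus is the number of edges outside a spanning tree. -/
theorem genus_add_card (hΓ : IsMetricGraph Γ) (M : EdgeModel Γ) :
    genus Γ + M.V.card = M.n + 1 := by
  classical
  have := hΓ.connected
  have hne : Nonempty M.V := by
    rcases M.cover_arc (Classical.arbitrary Γ) with h | ⟨e, -⟩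
    · exact ⟨⟨_, h⟩⟩
    · exact ⟨M.src e⟩
  set R := LinearMap.range (edgeDiff M.src M.tgt Finset.univ) with hR
  have hsurj : Function.Surjective (R.mkQ.comp M.edgeValues) :=
    R.mkQ_surjective.comp M.edgeValues_surjective
  have hker : LinearMap.ker (R.mkQ.comp M.edgeValues) =
      (LinearMap.range (coboundary Γ 0)).comap (LinearMap.ker (coboundary Γ 1)).subtype := by
    rw [LinearMap.ker_comp, Submodule.ker_mkQ, hR, comap_edgeValues hΓ]
  have hfin : genus Γ = Module.finrank ℝ (({e // e ∈ (Finset.univ : Finset (Fin M.n))} → ℝ) ⧸ R) := by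
    unfold genus H1
    rw [← hker]
    exact ((R.mkQ.comp M.edgeValues).quotKerEquivOfSurjective hsurj).finrank_eq
  have h1 := R.finrank_quotient_add_finrank
  rw [Module.finrank_fintype_fun_eq_card, Fintype.card_coe, Finset.card_univ, Fintype.card_fin] at h1
  have h2 := finrank_range_edgeDiff (M.edgeConnected_univ hΓ)
  rw [Fintype.card_coe, ← hR] at h2
  omega

end EdgeModel

/-! ### Contractibility of spanning trees -/

/-- A contractible closed set stays contractible when a segment is attached at one of its ends: the
segment can be squeezed into this end. -/
theorem contractibleSpace_union_segment {X : Type*} [MetricSpace X] {K : Set X} (hK : IsClosed K)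
    [ContractibleSpace K] {ℓ : ℝ} (hℓ : 0 ≤ ℓ) {q : ℝ → X}
    (hq : ∀ s ∈ Icc 0 ℓ, ∀ t ∈ Icc 0 ℓ, dist (q s) (q t) = |s - t|) (h0 : q 0 ∈ K)
    (hne : ∀ t ∈ Ioc 0 ℓ, q t ∉ K) : ContractibleSpace ↥(K ∪ q '' Icc 0 ℓ) := by
  classical
  have h0ℓ : (0 : ℝ) ∈ Icc 0 ℓ := ⟨le_rfl, hℓ⟩
  have hqc := continuousOn_of_dist_eq hq
  set A := q '' Icc 0 ℓ with hA
  have hAc : IsClosed A := (isCompact_Icc.image_of_continuousOn hqc).isClosed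
  let G : X × ℝ → X := fun z => if z.1 ∈ K then z.1 else q ((1 - z.2) * dist z.1 (q 0))
  have hGK : ∀ x ∈ K, ∀ s, G (x, s) = x := fun x hx s => if_pos hx
  have hdist : ∀ t ∈ Icc 0 ℓ, dist (q t) (q 0) = t := fun t ht => by
    rw [hq t ht 0 h0ℓ, sub_zero, abs_of_nonneg ht.1]
  have hGA : ∀ t ∈ Icc 0 ℓ, ∀ s, G (q t, s) = q ((1 - s) * dist (q t) (q 0)) := by
    intro t ht s
    rcases ht.1.eq_or_lt with rfl | ht0
    · rw [hGK _ h0, dist_self, mul_zero]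
    · exact if_neg (hne t ⟨ht0, ht.2⟩)
  have hmem : ∀ t ∈ Icc 0 ℓ, ∀ s ∈ Icc (0 : ℝ) 1, (1 - s) * dist (q t) (q 0) ∈ Icc 0 ℓ := by
    intro t ht s hs
    rw [hdist t ht]
    exact ⟨mul_nonneg (by linarith [hs.2]) ht.1, by nlinarith [hs.1, ht.1, ht.2]⟩
  have hGc : ContinuousOn G ((K ∪ A) ×ˢ Icc 0 1) := by
    rw [union_prod]
    refine ContinuousOn.union_of_isClosed ?_ ?_ (hK.prod isClosed_Icc) (hAc.prod isClosed_Icc)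
    · exact continuousOn_fst.congr fun z hz => hGK z.1 hz.1 z.2
    · have : ContinuousOn (fun z : X × ℝ => q ((1 - z.2) * dist z.1 (q 0))) (A ×ˢ Icc 0 1) := by
        refine hqc.comp (t := Icc 0 ℓ) (Continuous.continuousOn ?_) ?_
        · exact (continuous_const.sub continuous_snd).mul (continuous_fst.dist continuous_const)
        · rintro ⟨x, s⟩ ⟨⟨t, ht, rfl⟩, hs⟩
          exact hmem t ht s hs
      refine this.congr ?_
      rintro ⟨x, s⟩ ⟨⟨t, ht, rfl⟩, -⟩
      exact hGA t ht s
  have hGmem : ∀ x ∈ K ∪ A, ∀ s ∈ Icc (0 : ℝ) 1, G (x, s) ∈ K ∪ A := by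
    rintro x (hx | ⟨t, ht, rfl⟩) s hs
    · rw [hGK x hx]; exact Or.inl hx
    · rw [hGA t ht]; exact Or.inr ⟨_, hmem t ht s hs, rfl⟩
  have hG0 : ∀ x ∈ K ∪ A, G (x, 0) = x := by
    rintro x (hx | ⟨t, ht, rfl⟩)
    · exact hGK x hx 0
    · rw [hGA t ht, hdist t ht, sub_zero, one_mul]
  have hG1 : ∀ x ∈ K ∪ A, G (x, 1) ∈ K := by
    rintro x (hx | ⟨t, ht, rfl⟩)
    · rw [hGK x hx]; exact hx
    · rw [hGA t ht, sub_self, zero_mul]; exact h0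
  let r : C(↥(K ∪ A), K) := ⟨fun x => ⟨G (x, 1), hG1 x x.2⟩,
    Continuous.subtype_mk (hGc.comp_continuous (by fun_prop)
      fun x => ⟨x.2, zero_le_one, le_rfl⟩) _⟩
  let j : C(K, ↥(K ∪ A)) := ⟨inclusion subset_union_left, continuous_inclusion _⟩
  have hrj : r.comp j = ContinuousMap.id K := by
    ext x
    exact hGK x x.2 1
  have hjr : (ContinuousMap.id ↥(K ∪ A)).Homotopic (j.comp r) := ⟨
    { toFun := fun z => ⟨G (z.2, z.1), hGmem z.2 z.2.2 z.1 z.1.2⟩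
      continuous_toFun := Continuous.subtype_mk
        (hGc.comp_continuous (f := fun z : unitInterval × ↥(K ∪ A) => ((z.2 : X), (z.1 : ℝ)))
          (by fun_prop) fun z => ⟨z.2.2, z.1.2⟩) _
      map_zero_left := fun x => Subtype.ext (hG0 x x.2)
      map_one_left := fun x => rfl }⟩
  exact ContinuousMap.HomotopyEquiv.contractibleSpace
    ⟨r, j, hjr.symm, hrj ▸ ContinuousMap.Homotopic.refl _⟩

namespace EdgeModel

variable {Γ : Type*} [MetricSpace Γ] {M : EdgeModel Γ}

/-- The edges of a spanning tree form a contractible space. -/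
theorem contractibleSpace_compl {T : Finset (Fin M.n)}
    (hT : IsSpanningTree M.src M.tgt T) (v₀ : M.V) :
    ContractibleSpace ↥((⋃ e ∈ {e | e ∉ T}, M.inner e)ᶜ : Set Γ) := by
  classical
  let K : Finset M.V → Finset (Fin M.n) → Set Γ := fun U F =>
    (Subtype.val '' (U : Set M.V)) ∪ ⋃ f ∈ (F : Set (Fin M.n)), M.arc f
  have hKc : ∀ U F, IsClosed (K U F) := fun U F =>
    (U.finite_toSet.image _).isClosed.union
      (F.finite_toSet.isClosed_biUnion fun e _ => M.isClosed_arc e)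
  obtain ⟨F, hFT, hF, hcard⟩ := hT.conn.grow v₀ (fun U F => ContractibleSpace ↥(K U F)) (by
      have : K {v₀} ∅ = {(v₀ : Γ)} := by simp [K]
      rw [this]
      infer_instance) (by
    intro U F hP _ hFU e _ u hu w hw hends
    -- the edge `e` is parametrized starting from the end `u` in the old tree
    obtain ⟨q, hq, hq0, hql, hqarc, hqin⟩ : ∃ q : ℝ → Γ,
        (∀ s ∈ Icc 0 (M.len e), ∀ t ∈ Icc 0 (M.len e), dist (q s) (q t) = |s - t|) ∧
        q 0 = u ∧ q (M.len e) = w ∧ q '' Icc 0 (M.len e) = M.arc e ∧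
        ∀ t ∈ Ioo 0 (M.len e), q t ∈ M.inner e := by
      rcases hends with ⟨h1, h2⟩ | ⟨h1, h2⟩
      · exact ⟨M.γ e, M.dist_eq e, congrArg Subtype.val h1, congrArg Subtype.val h2, rfl,
          fun t ht => ⟨t, ht, rfl⟩⟩
      · refine ⟨fun t => M.γ e (M.len e - t), fun s hs t ht => ?_, ?_, ?_, ?_, fun t ht => ?_⟩
        · rw [M.dist_eq e _ ⟨by linarith [hs.2], by linarith [hs.1]⟩ _
            ⟨by linarith [ht.2], by linarith [ht.1]⟩, abs_sub_comm]
          congr 1; ring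
        · exact (congrArg (M.γ e) (sub_zero _)).trans (congrArg Subtype.val h2)
        · exact (congrArg (M.γ e) (sub_self _)).trans (congrArg Subtype.val h1)
        · ext x
          constructor
          · rintro ⟨t, ht, rfl⟩
            exact ⟨_, ⟨by linarith [ht.2], by linarith [ht.1]⟩, rfl⟩
          · rintro ⟨t, ht, rfl⟩
            exact ⟨M.len e - t, ⟨by linarith [ht.2], by linarith [ht.1]⟩, by simp⟩
        · exact ⟨_, ⟨by linarith [ht.2], by linarith [ht.1]⟩, rfl⟩
    have hVK : ∀ v : M.V, (v : Γ) ∈ K U F → v ∈ U := by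
      rintro v (⟨v', hv', h⟩ | h)
      · exact Subtype.ext h ▸ hv'
      · obtain ⟨f, hf, t, ht, h⟩ := mem_iUnion₂.1 h
        rcases M.eq_end_of_mem f ht (h ▸ v.2) with rfl | rfl
        · have : M.src f = v := Subtype.ext h
          exact this ▸ (hFU f hf).1
        · have : M.tgt f = v := Subtype.ext h
          exact this ▸ (hFU f hf).2
    have heF : e ∉ F := fun h => by
      rcases hends with ⟨-, h2⟩ | ⟨h1, -⟩
      · exact hw (h2 ▸ (hFU e h).2)
      · exact hw (h1 ▸ (hFU e h).1)
    have hqK : ∀ t ∈ Ioc 0 (M.len e), q t ∉ K U F := by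
      intro t ht hmem
      rcases ht.2.eq_or_lt with rfl | htl
      · rw [hql] at hmem
        exact hw (hVK w hmem)
      · obtain ⟨s, hs, hsq⟩ := hqin t ⟨ht.1, htl⟩
        rw [← hsq] at hmem
        rcases hmem with ⟨v, -, hv⟩ | hmem
        · exact M.notMem e s hs (hv ▸ v.2)
        · obtain ⟨f, hf, t', ht', h⟩ := mem_iUnion₂.1 hmem
          obtain ⟨hef, -⟩ := M.eq_of_inner e f hs ht' h.symm
          exact heF (hef ▸ hf)
    have hu0 : q 0 ∈ K U F := by
      rw [hq0]; exact Or.inl ⟨u, hu, rfl⟩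
    have := contractibleSpace_union_segment (hKc U F) (M.len_pos e).le hq hu0 hqK
    have hKeq : K (insert w U) (insert e F) = K U F ∪ q '' Icc 0 (M.len e) := by
      have hwA : (w : Γ) ∈ M.arc e := by
        rw [← hqarc, ← hql]
        exact ⟨_, M.right_mem e, rfl⟩
      simp only [K, hqarc, Finset.coe_insert, image_insert_eq, biUnion_insert]
      ext x
      simp only [mem_union, mem_insert_iff]
      constructor
      · rintro ((rfl | h) | (h | h))
        · exact Or.inr hwA
        · exact Or.inl (Or.inl h)
        · exact Or.inr h
        · exact Or.inl (Or.inr h)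
      · tauto
    rw [hKeq]
    exact this)
  -- a subset of the tree of the same cardinality is the tree
  have hFT' : F = T := Finset.eq_of_subset_of_card_le hFT (by have := hT.card; omega)
  subst hFT'
  have hK : K Finset.univ F = (⋃ e ∈ {e | e ∉ F}, M.inner e)ᶜ := by
    ext x
    simp only [K, mem_union, mem_compl_iff, mem_iUnion₂, not_exists]
    constructor
    · rintro (⟨v, -, rfl⟩ | ⟨f, hf, t, ht, rfl⟩) e he ⟨s, hs, h⟩
      · exact M.notMem e s hs (h ▸ v.2)
      · exact he ((M.eq_of_inner e f hs ht h).1 ▸ hf)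
    · intro h
      rcases M.cover x with hx | ⟨e, hx⟩
      · exact Or.inl ⟨⟨x, hx⟩, by simp, rfl⟩
      · refine Or.inr ⟨e, ?_, M.inner_subset_arc e hx⟩
        by_contra he
        exact h e he hx
  rw [← hK]
  exact hF

end EdgeModel

namespace EdgeModel

variable {Γ : Type*} [MetricSpace Γ] {M : EdgeModel Γ}

/-! ### Semibreak divisors in a linear system -/

/-- Chips on distinct edges outside a spanning tree form a semibreak divisor: the break divisor above
it has one chip on each edge outside the tree. -/
theorem isSemibreakDivisor_chips (hΓ : IsMetricGraph Γ) {T A : Finset (Fin M.n)}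
    {pos : Fin M.n → ℝ} (hT : IsSpanningTree M.src M.tgt T) (hAT : Disjoint A T)
    (hpos : ∀ e, pos e ∈ Icc 0 (M.len e)) : IsSemibreakDivisor (M.chips A pos) := by
  classical
  have := hΓ.connected
  obtain ⟨v₀⟩ : Nonempty M.V := by
    rcases M.cover_arc (Classical.arbitrary Γ) with h | ⟨e, -⟩
    · exact ⟨⟨_, h⟩⟩
    · exact ⟨M.src e⟩
  have hsingle : ∀ x : Γ, 0 ≤ Finsupp.single x (1 : ℤ) := fun x =>
    Finsupp.single_nonneg.2 zero_le_one
  refine ⟨Finset.sum_nonneg fun e _ => hsingle _, M.chips Tᶜ pos, ?_,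
    Finset.sum_le_sum_of_subset_of_nonneg
      (fun e he => Finset.mem_compl.2 (Finset.disjoint_left.1 hAT he)) fun e _ _ => hsingle _⟩
  have hcard : (Tᶜ : Finset (Fin M.n)).card = genus Γ := by
    have h1 := genus_add_card hΓ M
    have h2 := hT.card
    rw [Fintype.card_coe] at h2
    rw [Finset.card_compl, Fintype.card_fin]
    omega
  let k : Fin (genus Γ) ≃ {e // e ∈ (Tᶜ : Finset (Fin M.n))} := (Finset.equivFinOfCardEq hcard).symm
  refine ⟨fun i => M.inner (k i).1, fun i => M.γ (k i).1 (pos (k i).1),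
    fun i => M.isOpenEdgeSegment_inner _, fun i j hij => M.disjoint _ _ fun h =>
      hij (k.injective (Subtype.ext h)), fun i => M.arc_subset_closure _ ⟨_, hpos _, rfl⟩, ?_, ?_⟩
  · rw [chips, ← Finset.sum_coe_sort]
    exact (Equiv.sum_comp k fun e => Finsupp.single (M.γ e.1 (pos e.1)) (1 : ℤ)).symm
  · have hU : (⋃ i, M.inner (k i).1) = ⋃ e ∈ {e | e ∉ T}, M.inner e := by
      ext x
      simp only [mem_iUnion, mem_ofPred_eq, exists_prop]
      constructor
      · rintro ⟨i, hi⟩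
        exact ⟨_, Finset.mem_compl.1 (k i).2, hi⟩
      · rintro ⟨e, he, hx⟩
        obtain ⟨i, hi⟩ := k.surjective ⟨e, Finset.mem_compl.2 he⟩
        exact ⟨i, by rw [hi]; exact hx⟩
    rw [hU]
    exact contractibleSpace_compl hT v₀

end EdgeModel

end

end TropicalGraph

theorem theorem5p1 (Γ : Type*) [MetricSpace Γ] (hΓ : TropicalGraph.IsMetricGraph Γ)
    (d : ℕ) (hd : d ≤ TropicalGraph.genus Γ)
    (D : Γ →₀ ℤ) (hD : Finsupp.degree D = (d : ℤ))
    (hne : (TropicalGraph.linearSystem D).Nonempty) :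
    ∃ E ∈ TropicalGraph.linearSystem D, TropicalGraph.IsSemibreakDivisor E := by
  classical
  obtain ⟨E₀, hE₀, φ₀, hφ₀, hdiv⟩ := hne
  obtain ⟨M, hM⟩ := TropicalGraph.exists_edgeModel hΓ (E₀.support ∪ D.support)
  have hdeg := M.degree_eq_zero hφ₀ hdiv fun p hp => hM (by
    by_contra h
    rw [Finset.mem_union, not_or, Finsupp.notMem_support_iff, Finsupp.notMem_support_iff] at h
    exact hp (by rw [Finsupp.sub_apply, h.1, h.2, sub_zero]))
  rw [map_sub, hD, sub_eq_zero] at hdeg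
  have hg := TropicalGraph.EdgeModel.genus_add_card hΓ M
  obtain ⟨T, A, pos, hT, hAT, -, hpos, φ, hφ⟩ := TropicalGraph.EdgeModel.exists_chips hΓ d
    (by omega) E₀ hE₀ (fun p hp => hM (Finset.mem_union_left _ (Finsupp.mem_support_iff.2 hp))) hdeg
  have hsemi := TropicalGraph.EdgeModel.isSemibreakDivisor_chips hΓ hT hAT hpos
  refine ⟨M.chips A pos, ⟨hsemi.1, _, hφ.rational.add hφ₀, ?_⟩, hsemi⟩
  have := hφ.add_isDivisorOf hdiv
  rwa [sub_add_sub_cancel] at this
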